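/- **Setting.** A differentiable $F:\mathbb R\to\mathbb R$ is *$H$-smooth* if $F(y)\le F(x)+F'(x)(y-x)+\frac H2(y-x)^2$ for all $x,y$. Fix an initial point $x_0\in\mathbb R$. Let $\mathcal F_{\mathrm{DB}}[H,R]$ be the set of convex $H$-smooth $F:\mathbb R\to\mathbb R$ that have a minimizer $x^*$ with $|x_0-x^*|\le R$, and let $\mathcal F_{\mathrm{RB}}[H,\Delta]$ be the set of convex $H$-smooth $F:\mathbb R\to\mathbb R$ that have a minimizer $x^*$ and satisfy $F(x_0)-F(x^*)\le\Delta$. A *stochastic first-order oracle* for $F$ with variance bound $\sigma^2$ is given by a probability distribution $\mathcal D$ and a (jointly measurable) function $f(x;z)$, differentiable in $x$ for every $z$, with $F(x)=\mathbb E_{z\sim\mathcal D}[f(x;z)]$ and $\mathbb E_{z\sim\mathcal D}|f'(x;z)-F'(x)|^2\le\sigma^2$ for every $x$; when queried at $x$ it draws an independent $z\sim\mathcal D$ and returns $(f(x;z),f'(x;z))$. An *algorithm* is a measurable, possibly randomized, adaptive procedure: on the basis of its internal randomness and the answers so far it either makes another query or halts and returns a point $\hat x\in\mathbb R$. It *returns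 an $\epsilon$-stationary point with probability at least $\delta$* on $(F,\mathcal O)$ if, interacting with the oracle $\mathcal O$ of $F$, it halts and $|F'(\hat x)|\le\epsilon$ with probability at least $\delta$. The expected number of queries is $\infty$ if it fails to halt with positive probability. **Theorem.** For every $\delta\in(0,1)$ there are constants $c>0$ and $K\ge1$, depending only on $\delta$, with $K=1$ whenever $\delta>1/2$, such that the following holds for every $x_0\in\mathbb R$. 1. For all $H,R,\sigma>0$ and $\epsilon\in(0,\sigma/2)$ with $HR/\epsilon\ge K$ there is a finite family of functions $F_1,\dots,F_N\in\mathcal F_{\mathrm{DB}}[H,R]$ with stochastic first-order oracles $\mathcal O_1,\dots,\mathcal O_N$ for them, with variance bound $\sigma^2$, such that for every algorithm that returns an $\epsilon$-stationary point with probability at least $\delta$ on each $(F_i,\mathcal O_i)$ there is an $i$ for which the expected number of queries on $(F_i,\mathcal O_i)$ is at least $$c\,\frac{\sigma^2}{\epsilon^2}\log\Big(\frac{HR}{\epsilon}\Big).$$ 2. For all $H,\Delta,\sigma>0$ and $\epsilon\in(0,\sigma/2)$ with $H\Delta/\epsilon^2\ge K$ the same holds with $\mathcal F_{\mathrm{RB}}[H,\Delta]$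 in place of $\mathcal F_{\mathrm{DB}}[H,R]$ and with the lower bound $$c\,\frac{\sigma^2}{\epsilon^2}\log\Big(\frac{H\Delta}{\epsilon^2}\Big).$$ -/

import Mathlib

open MeasureTheory

universe u

/-- `F : ℝ → ℝ` is differentiable and `H`-smooth: the quadratic upper bound with constant `H`
holds at every point. -/
def IsHSmooth (H : ℝ) (F : ℝ → ℝ) : Prop :=
  Differentiable ℝ F ∧
    ∀ x y : ℝ, F y ≤ F x + deriv F x * (y - x) + H / 2 * (y - x) ^ 2

/-- Domain-bounded functions: convex, `H`-smooth functions on the line that have a minimiser at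
distance at most `R` from the initial point `x₀`. -/
def DomainBounded (H R x₀ : ℝ) : Set (ℝ → ℝ) :=
  {F | IsHSmooth H F ∧ ConvexOn ℝ Set.univ F ∧
    ∃ xstar : ℝ, (∀ x, F xstar ≤ F x) ∧ |x₀ - xstar| ≤ R}

/-- Range-bounded functions: convex, `H`-smooth functions on the line that have a minimiser and
whose value at the initial point `x₀` exceeds the minimum by at most `Δ`. -/
def RangeBounded (H Δ x₀ : ℝ) : Set (ℝ → ℝ) :=
  {F | IsHSmooth H F ∧ ConvexOn ℝ Set.univ F ∧
    ∃ xstar : ℝ, (∀ x, F xstar ≤ F x) ∧ F x₀ - F xstar ≤ Δ}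

/-- A stochastic first-order oracle for `F` with variance bound `σ ^ 2`: a random function
`f (·; z)`, `z ∼ D`, with mean `F`, whose gradient deviates from that of `F` by at most `σ ^ 2`
in mean square at every point. -/
structure StochasticOracle (F : ℝ → ℝ) (σ : ℝ) where
  /-- the space of noise variables -/
  Z : Type
  [measurableSpaceZ : MeasurableSpace Z]
  /-- the distribution of the noise variable -/
  D : Measure Z
  [isProbabilityMeasureD : IsProbabilityMeasure D]
  /-- the random function -/
  f : ℝ → Z → ℝ
  measurable_f : Measurable (fun p : ℝ × Z => f p.1 p.2)
  differentiable_f : ∀ z, Differentiable ℝ (fun x => f x z)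
  integrable_f : ∀ x, Integrable (f x) D
  mean_f : ∀ x, ∫ z, f x z ∂D = F x
  variance_le : ∀ x,
    ∫⁻ z, ENNReal.ofReal ((deriv (fun y => f y z) x - deriv F x) ^ 2) ∂D ≤ ENNReal.ofReal (σ ^ 2)

attribute [instance] StochasticOracle.measurableSpaceZ StochasticOracle.isProbabilityMeasureD

/-- The answer `(f (x; z), f' (x; z))` of the oracle to the query `x` when it draws `z`. -/
noncomputable def StochasticOracle.answer {F : ℝ → ℝ} {σ : ℝ} (O : StochasticOracle F σ)
    (x : ℝ) (z : O.Z) : ℝ × ℝ :=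
  (O.f x z, deriv (fun y => O.f y z) x)

/-- A (possibly randomized) adaptive algorithm interacting with a first-order oracle on the line.
It draws a random seed once. After having received `n` answers it decides, on the basis of the
seed and these answers, whether to halt; if it halts it returns `output n`, and otherwise it
queries the oracle at `query n`. Deterministic algorithms are those with a one-point seed space. -/
structure OracleAlgorithm where
  /-- the space of seeds -/
  Seed : Type u
  [measurableSpaceSeed : MeasurableSpace Seed]
  /-- the distribution of the seed -/
  seedLaw : Measure Seed
  [isProbabilityMeasureSeedLaw : IsProbabilityMeasure seedLaw]
  /-- the situations, after `n` answers, in which the algorithm halts -/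
  halt : (n : ℕ) → Set (Seed × (Fin n → ℝ × ℝ))
  /-- the next query after `n` answers -/
  query : (n : ℕ) → Seed × (Fin n → ℝ × ℝ) → ℝ
  /-- the point returned if the algorithm halts after `n` answers -/
  output : (n : ℕ) → Seed × (Fin n → ℝ × ℝ) → ℝ
  measurableSet_halt : ∀ n, MeasurableSet (halt n)
  measurable_query : ∀ n, Measurable (query n)
  measurable_output : ∀ n, Measurable (output n)

attribute [instance] OracleAlgorithm.measurableSpaceSeed
  OracleAlgorithm.isProbabilityMeasureSeedLaw

namespace OracleAlgorithm

variable (A : OracleAlgorithm.{u}) {F : ℝ → ℝ} {σ : ℝ} (O : StochasticOracle F σ)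

/-- The first `n` answers received when the seed is `s` and the oracle draws `z 0, z 1, …`
(with the algorithm being continued, for definiteness, after it has halted). -/
noncomputable def answers (s : A.Seed) (z : ℕ → O.Z) : (n : ℕ) → Fin n → ℝ × ℝ
  | 0 => Fin.elim0
  | n + 1 => Fin.snoc (α := fun _ => ℝ × ℝ) (answers s z n)
      (O.answer (A.query n (s, answers s z n)) (z n))

/-- The algorithm halts (or would halt) after `n` answers. -/
def HaltsAt (s : A.Seed) (z : ℕ → O.Z) (n : ℕ) : Prop :=
  (s, A.answers O s z n) ∈ A.halt n

/-- The joint law of the seed and of the independent draws of the oracle. -/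
noncomputable def runLaw : Measure (A.Seed × (ℕ → O.Z)) :=
  A.seedLaw.prod (Measure.infinitePi fun _ : ℕ => O.D)

/-- The number of queries made before the algorithm halts (`∞` if it never halts). -/
noncomputable def numQueries (s : A.Seed) (z : ℕ → O.Z) : ENNReal :=
  ⨅ (n : ℕ) (_ : A.HaltsAt O s z n), (n : ENNReal)

/-- The expected number of queries. -/
noncomputable def expectedQueries : ENNReal :=
  ∫⁻ ω, A.numQueries O ω.1 ω.2 ∂(A.runLaw O)

/-- The event that the algorithm halts and returns an `ε`-stationary point of `F`. -/
def successEvent (ε : ℝ) : Set (A.Seed × (ℕ → O.Z)) :=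
  {ω | ∃ n : ℕ, A.HaltsAt O ω.1 ω.2 n ∧ (∀ m < n, ¬ A.HaltsAt O ω.1 ω.2 m) ∧
    |deriv F (A.output n (ω.1, A.answers O ω.1 ω.2 n))| ≤ ε}

/-- The probability that the algorithm halts and returns an `ε`-stationary point of `F`. -/
noncomputable def successProb (ε : ℝ) : ENNReal :=
  A.runLaw O (A.successEvent O ε)

end OracleAlgorithm

/-- On some finite family of pairs (function of the class `C`, oracle for it with variance bound
`σ ^ 2`), fixed before the algorithm, every algorithm that returns an `ε`-stationary point with
probability at least `δ` on every member makes at least `b` expected queries on some member. -/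
def HasQueryLowerBound (C : Set (ℝ → ℝ)) (σ ε δ b : ℝ) : Prop :=
  ∃ (N : ℕ) (F : Fin N → ℝ → ℝ) (O : (i : Fin N) → StochasticOracle (F i) σ),
    (∀ i, F i ∈ C) ∧
    ∀ A : OracleAlgorithm.{u},
      (∀ i, ENNReal.ofReal δ ≤ A.successProb (O i) ε) →
        ∃ i, ENNReal.ofReal b ≤ A.expectedQueries (O i)

/-!
Finding an `ε`-stationary point is made as hard as identifying one of `N ≈ H R / ε` hypotheses
from noisy data. The functions are Huber functions: the gradient is `H (x - c)` truncated to
`[-2 ε, 2 ε]`, so that the `ε`-stationary points form the interval of radius `ε / H` around the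
centre `c`, and `N` centres at distance at most `R` from `x₀` can be chosen for which these
intervals are disjoint (`exists_separated_centres`).

The oracle adds a random affine function `z₁ + z₂ (x - x₀)` with Gaussian coefficients. The variance
of `z₂` is `σ ^ 2`. The variance of `z₁` is free, and since the tangent lines of two of the functions
have uniformly close intercepts at `x₀` (`abs_huber_intercept_le`), it can be taken so large that
function values carry next to no information. Compared with the oracle of the Huber function
centred at `x₀`, a single answer then has relative entropy at most `9 ε ^ 2 / σ ^ 2`, because it is
the reference answer with shifted Gaussian noise (`answerEntropyLE_gaussianOracle`).

The relative entropy of the whole stopped interaction is never formed. It is replaced by the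
variational inequality
`l * P (S) ≤ κ * E_P [number of queries] + log (1 + (exp l - 1) * Q (S))`, for `l ≥ 0`,
where `P` and `Q` are the laws of the run with the given and with the reference oracle. It is proved
by induction on the number of remaining queries, from any history (`mul_meanPayoff_le`): one step
is the Donsker–Varadhan inequality for a single answer. Under the reference oracle the disjoint
stationary sets are hit with total probability at most `1`, hence one of them with probability
at most `1 / N`; for the corresponding function the inequality with a suitable `l` bounds the
expected number of queries from below by a multiple of `σ ^ 2 / ε ^ 2 * log N`
(`exists_const_mul_log_le`).

Functions with initial gap `Δ` are covered by those with a minimiser within `√(Δ / H)`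
(`domainBounded_subset_rangeBounded`).
-/

open Filter Topology ProbabilityTheory
open scoped NNReal

/-! ### Stopped payoffs of an algorithm -/

lemma measurable_snoc {X : Type*} [MeasurableSpace X] (k : ℕ) :
    Measurable (fun p : (Fin k → X) × X => Fin.snoc (α := fun _ => X) p.1 p.2) := by
  refine measurable_pi_iff.2 fun i => ?_
  induction i using Fin.lastCases with
  | last => simpa using measurable_snd
  | cast i => simpa [Function.comp_def] using
      (measurable_pi_apply (X := fun _ : Fin k => X) i).comp measurable_fst

namespace OracleAlgorithm

variable (A : OracleAlgorithm.{u}) {Z : Type*}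

/-- The seed and history after one more query, answered by `ans` with noise `w`. -/
noncomputable def extend (ans : ℝ → Z → ℝ × ℝ) (k : ℕ) (h : A.Seed × (Fin k → ℝ × ℝ)) (w : Z) :
    A.Seed × (Fin (k + 1) → ℝ × ℝ) :=
  (h.1, Fin.snoc (α := fun _ => ℝ × ℝ) h.2 (ans (A.query k h) w))

open Classical in
/-- The payoff collected when the algorithm is continued from the seed and history `h` after
`k` answers, for at most `m` further queries: every query earns `c`, and halting with a history
in `S` earns `1`. The `k`-th query is answered with the noise `z k`, so that the payoff depends on
`z` only through the coordinates from `k` on. The number of queries is the case `c = 1`, `S = ∅`,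
and the indicator of success the case `c = 0`. -/
noncomputable def payoff (ans : ℝ → Z → ℝ × ℝ) (c : ℝ)
    (S : (k : ℕ) → Set (A.Seed × (Fin k → ℝ × ℝ))) :
    (m k : ℕ) → A.Seed × (Fin k → ℝ × ℝ) → (ℕ → Z) → ℝ
  | 0, k, h, _ => if h ∈ A.halt k then (S k).indicator 1 h else 0
  | m + 1, k, h, z => if h ∈ A.halt k then (S k).indicator 1 h else
      c + payoff ans c S m (k + 1) (A.extend ans k h (z k)) z

variable {A} {ans : ℝ → Z → ℝ × ℝ} {c : ℝ} {S : (k : ℕ) → Set (A.Seed × (Fin k → ℝ × ℝ))}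

lemma payoff_of_mem_halt {m k : ℕ} {h : A.Seed × (Fin k → ℝ × ℝ)} (hh : h ∈ A.halt k)
    (z : ℕ → Z) : A.payoff ans c S m k h z = (S k).indicator 1 h := by
  cases m <;> simp [payoff, hh]

lemma payoff_zero_of_notMem_halt {k : ℕ} {h : A.Seed × (Fin k → ℝ × ℝ)} (hh : h ∉ A.halt k)
    (z : ℕ → Z) : A.payoff ans c S 0 k h z = 0 := by
  simp [payoff, hh]

lemma payoff_succ_of_notMem_halt {m k : ℕ} {h : A.Seed × (Fin k → ℝ × ℝ)} (hh : h ∉ A.halt k)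
    (z : ℕ → Z) : A.payoff ans c S (m + 1) k h z =
      c + A.payoff ans c S m (k + 1) (A.extend ans k h (z k)) z := by
  simp [payoff, hh]

lemma payoff_nonneg (hc : 0 ≤ c) (m k : ℕ) (h : A.Seed × (Fin k → ℝ × ℝ)) (z : ℕ → Z) :
    0 ≤ A.payoff ans c S m k h z := by
  induction m generalizing k with
  | zero =>
    by_cases hh : h ∈ A.halt k
    · rw [payoff_of_mem_halt hh]
      exact Set.indicator_nonneg (fun _ _ => zero_le_one) _
    · rw [payoff_zero_of_notMem_halt hh]
  | succ m ih =>
    by_cases hh : h ∈ A.halt k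
    · rw [payoff_of_mem_halt hh]
      exact Set.indicator_nonneg (fun _ _ => zero_le_one) _
    · rw [payoff_succ_of_notMem_halt hh]
      exact add_nonneg hc (ih _ _)

lemma payoff_le (hc : 0 ≤ c) (m k : ℕ) (h : A.Seed × (Fin k → ℝ × ℝ)) (z : ℕ → Z) :
    A.payoff ans c S m k h z ≤ m * c + 1 := by
  have hind : ∀ (m k : ℕ) (h : A.Seed × (Fin k → ℝ × ℝ)),
      (S k).indicator (1 : A.Seed × (Fin k → ℝ × ℝ) → ℝ) h ≤ m * c + 1 := fun m k h => by
    have h1 : (S k).indicator (1 : A.Seed × (Fin k → ℝ × ℝ) → ℝ) h ≤ 1 :=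
      Set.indicator_apply_le' (fun _ => le_rfl) (fun _ => zero_le_one)
    have h2 : 0 ≤ m * c := by positivity
    linarith
  induction m generalizing k with
  | zero =>
    by_cases hh : h ∈ A.halt k
    · rw [payoff_of_mem_halt hh]
      exact hind 0 k h
    · rw [payoff_zero_of_notMem_halt hh]
      simp
  | succ m ih =>
    by_cases hh : h ∈ A.halt k
    · rw [payoff_of_mem_halt hh]
      exact hind _ k h
    · rw [payoff_succ_of_notMem_halt hh]
      have := ih (k + 1) (A.extend ans k h (z k))
      push_cast
      linarith

lemma payoff_update (m : ℕ) {k j : ℕ} (hj : j < k) (h : A.Seed × (Fin k → ℝ × ℝ)) (z : ℕ → Z)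
    (w : Z) : A.payoff ans c S m k h (Function.update z j w) = A.payoff ans c S m k h z := by
  induction m generalizing k with
  | zero => rfl
  | succ m ih =>
    by_cases hh : h ∈ A.halt k
    · simp [payoff_of_mem_halt hh]
    · rw [payoff_succ_of_notMem_halt hh, payoff_succ_of_notMem_halt hh, ih (hj.trans k.lt_succ_self),
        Function.update_of_ne hj.ne']

variable [MeasurableSpace Z]

lemma measurable_extend (hans : Measurable (fun p : ℝ × Z => ans p.1 p.2)) (k : ℕ) :
    Measurable (fun p : (A.Seed × (Fin k → ℝ × ℝ)) × Z => A.extend ans k p.1 p.2) := by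
  have h1 : Measurable (fun p : (A.Seed × (Fin k → ℝ × ℝ)) × Z => ans (A.query k p.1) p.2) :=
    hans.comp (((A.measurable_query k).comp measurable_fst).prodMk measurable_snd)
  exact measurable_fst.fst.prodMk ((measurable_snoc k).comp (measurable_fst.snd.prodMk h1))

lemma measurable_payoff (hans : Measurable (fun p : ℝ × Z => ans p.1 p.2))
    (hS : ∀ k, MeasurableSet (S k)) (m k : ℕ) :
    Measurable (fun p : (A.Seed × (Fin k → ℝ × ℝ)) × (ℕ → Z) => A.payoff ans c S m k p.1 p.2) := by
  have hind : ∀ k, Measurable (fun p : (A.Seed × (Fin k → ℝ × ℝ)) × (ℕ → Z) =>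
      (S k).indicator (1 : A.Seed × (Fin k → ℝ × ℝ) → ℝ) p.1) := fun k =>
    (measurable_one.indicator (hS k)).comp measurable_fst
  induction m generalizing k with
  | zero =>
    exact Measurable.ite (measurable_fst (A.measurableSet_halt k)) (hind k) measurable_const
  | succ m ih =>
    refine Measurable.ite (measurable_fst (A.measurableSet_halt k)) (hind k)
      (measurable_const.add ((ih (k + 1)).comp (Measurable.prodMk ?_ measurable_snd)))
    exact (measurable_extend hans k).comp
      (measurable_fst.prodMk ((measurable_pi_apply k).comp measurable_snd))

end OracleAlgorithm

/-! ### Integrating out one coordinate of the noise -/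

lemma integrable_of_measurable_bounded {X : Type*} [MeasurableSpace X] {μ : Measure X}
    [IsFiniteMeasure μ] {f : X → ℝ} (hf : Measurable f) {a b : ℝ} (h : ∀ x, f x ∈ Set.Icc a b) :
    Integrable f μ :=
  Integrable.of_mem_Icc a b hf.aemeasurable (.of_forall h)

/-- Resampling the `k`-th coordinate of an i.i.d. sequence does not change its law. -/
lemma measurePreserving_update_infinitePi {Z : Type*} [MeasurableSpace Z] (D : Measure Z)
    [IsProbabilityMeasure D] (k : ℕ) :
    MeasurePreserving (fun p : Z × (ℕ → Z) => Function.update p.2 k p.1)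
      (D.prod (Measure.infinitePi fun _ : ℕ => D)) (Measure.infinitePi fun _ : ℕ => D) := by
  have hm : Measurable (fun p : Z × (ℕ → Z) => Function.update p.2 k p.1) := by
    refine measurable_pi_iff.2 fun i => ?_
    by_cases hi : i = k
    · subst hi
      simpa using measurable_fst
    · simpa [Function.update_of_ne hi, Function.comp_def] using
        (measurable_pi_apply i).comp measurable_snd
  refine ⟨hm, Measure.eq_infinitePi _ fun s t ht => ?_⟩
  rw [Measure.map_apply hm (MeasurableSet.pi s.countable_toSet fun i _ => ht i)]
  by_cases hk : k ∈ s
  · have : (fun p : Z × (ℕ → Z) => Function.update p.2 k p.1) ⁻¹' (Set.pi s t) =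
        t k ×ˢ Set.pi (s.erase k) t := by
      ext p
      simp only [Set.mem_preimage, Set.mem_pi, Set.mem_prod, Finset.mem_coe, Finset.mem_erase]
      constructor
      · intro h
        refine ⟨by simpa using h k hk, fun i hi => by
          simpa [Function.update_of_ne hi.1] using h i hi.2⟩
      · rintro ⟨h1, h2⟩ i hi
        by_cases hik : i = k
        · subst hik; simpa using h1
        · simpa [Function.update_of_ne hik] using h2 i ⟨hik, hi⟩
    rw [this, Measure.prod_prod, Measure.infinitePi_pi _ (fun i _ => ht i),
      Finset.mul_prod_erase s (fun i => D (t i)) hk]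
  · have : (fun p : Z × (ℕ → Z) => Function.update p.2 k p.1) ⁻¹' (Set.pi s t) =
        Set.univ ×ˢ Set.pi s t := by
      ext p
      simp only [Set.mem_preimage, Set.mem_pi, Set.mem_prod, Finset.mem_coe, Set.mem_univ,
        true_and]
      refine forall₂_congr fun i hi => ?_
      rw [Function.update_of_ne (by rintro rfl; exact hk hi)]
    rw [this, Measure.prod_prod, Measure.infinitePi_pi _ (fun i _ => ht i), measure_univ, one_mul]

namespace OracleAlgorithm

variable {A : OracleAlgorithm.{u}} {Z : Type*} [MeasurableSpace Z]
variable {ans : ℝ → Z → ℝ × ℝ} {c : ℝ} {S : (k : ℕ) → Set (A.Seed × (Fin k → ℝ × ℝ))}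
variable {D : Measure Z}

variable (A ans c S D) in
/-- The expected payoff from the seed and history `h` on. -/
noncomputable def meanPayoff (m k : ℕ) (h : A.Seed × (Fin k → ℝ × ℝ)) : ℝ :=
  ∫ z, A.payoff ans c S m k h z ∂(Measure.infinitePi fun _ : ℕ => D)

lemma meanPayoff_zero_of_notMem_halt {k : ℕ} {h : A.Seed × (Fin k → ℝ × ℝ)}
    (hh : h ∉ A.halt k) : A.meanPayoff ans c S D 0 k h = 0 := by
  simp [meanPayoff, payoff_zero_of_notMem_halt hh]

variable [IsProbabilityMeasure D]

lemma meanPayoff_of_mem_halt {m k : ℕ} {h : A.Seed × (Fin k → ℝ × ℝ)} (hh : h ∈ A.halt k) :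
    A.meanPayoff ans c S D m k h = (S k).indicator 1 h := by
  simp [meanPayoff, payoff_of_mem_halt hh]

lemma measurable_meanPayoff (hans : Measurable (fun p : ℝ × Z => ans p.1 p.2))
    (hS : ∀ k, MeasurableSet (S k)) (m k : ℕ) : Measurable (A.meanPayoff ans c S D m k) :=
  (measurable_payoff hans hS m k).stronglyMeasurable.integral_prod_right.measurable

lemma integrable_payoff (hans : Measurable (fun p : ℝ × Z => ans p.1 p.2))
    (hS : ∀ k, MeasurableSet (S k)) (hc : 0 ≤ c) (m k : ℕ) (h : A.Seed × (Fin k → ℝ × ℝ)) :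
    Integrable (A.payoff ans c S m k h) (Measure.infinitePi fun _ : ℕ => D) :=
  integrable_of_measurable_bounded ((measurable_payoff hans hS m k).comp measurable_prodMk_left)
    (fun z => ⟨payoff_nonneg hc m k h z, payoff_le hc m k h z⟩)

lemma meanPayoff_mem_Icc (hans : Measurable (fun p : ℝ × Z => ans p.1 p.2))
    (hS : ∀ k, MeasurableSet (S k)) (hc : 0 ≤ c) (m k : ℕ) (h : A.Seed × (Fin k → ℝ × ℝ)) :
    A.meanPayoff ans c S D m k h ∈ Set.Icc 0 (m * c + 1) := by
  refine ⟨integral_nonneg fun z => payoff_nonneg hc m k h z, ?_⟩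
  calc A.meanPayoff ans c S D m k h
      ≤ ∫ _, (m * c + 1) ∂(Measure.infinitePi fun _ : ℕ => D) :=
        integral_mono (integrable_payoff hans hS hc m k h) (integrable_const _)
          (fun z => payoff_le hc m k h z)
    _ = m * c + 1 := by simp

/-- Dynamic programming equation: the noise of the next query is integrated out separately. -/
lemma meanPayoff_succ_of_notMem_halt (hans : Measurable (fun p : ℝ × Z => ans p.1 p.2))
    (hS : ∀ k, MeasurableSet (S k)) (hc : 0 ≤ c) {m k : ℕ} {h : A.Seed × (Fin k → ℝ × ℝ)}
    (hh : h ∉ A.halt k) :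
    A.meanPayoff ans c S D (m + 1) k h =
      c + ∫ w, A.meanPayoff ans c S D m (k + 1) (A.extend ans k h w) ∂D := by
  have hmeas : Measurable (fun p : Z × (ℕ → Z) =>
      A.payoff ans c S m (k + 1) (A.extend ans k h p.1) p.2) :=
    (measurable_payoff hans hS m (k + 1)).comp
      (((measurable_extend hans k).comp (measurable_const.prodMk measurable_fst)).prodMk
        measurable_snd)
  have hpair : Measurable (fun z : ℕ → Z => (z k, z)) :=
    (measurable_pi_apply k).prodMk measurable_id
  have hmeas' : Measurable (fun z : ℕ → Z =>
      A.payoff ans c S m (k + 1) (A.extend ans k h (z k)) z) :=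
    hmeas.comp hpair
  have hint : Integrable (fun p : Z × (ℕ → Z) =>
      A.payoff ans c S m (k + 1) (A.extend ans k h p.1) p.2)
      (D.prod (Measure.infinitePi fun _ : ℕ => D)) :=
    integrable_of_measurable_bounded hmeas
      (fun p => ⟨payoff_nonneg hc _ _ _ _, payoff_le hc _ _ _ _⟩)
  have hint' : Integrable (fun z : ℕ → Z =>
      A.payoff ans c S m (k + 1) (A.extend ans k h (z k)) z)
      (Measure.infinitePi fun _ : ℕ => D) :=
    integrable_of_measurable_bounded hmeas'
      (fun p => ⟨payoff_nonneg hc _ _ _ _, payoff_le hc _ _ _ _⟩)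
  have hmp := measurePreserving_update_infinitePi D k
  calc A.meanPayoff ans c S D (m + 1) k h
      = ∫ z, (c + A.payoff ans c S m (k + 1) (A.extend ans k h (z k)) z)
          ∂(Measure.infinitePi fun _ : ℕ => D) := by
        simp only [meanPayoff, payoff_succ_of_notMem_halt hh]
    _ = c + ∫ z, A.payoff ans c S m (k + 1) (A.extend ans k h (z k)) z
          ∂(Measure.infinitePi fun _ : ℕ => D) := by
        rw [integral_add (integrable_const _) hint']; simp
    _ = c + ∫ p, A.payoff ans c S m (k + 1) (A.extend ans k h p.1) p.2
          ∂(D.prod (Measure.infinitePi fun _ : ℕ => D)) := by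
        rw [← hmp.map_eq, integral_map hmp.measurable.aemeasurable
          hmeas'.aestronglyMeasurable]
        simp only [Function.update_self, payoff_update m k.lt_succ_self, hmp.map_eq]
    _ = c + ∫ w, A.meanPayoff ans c S D m (k + 1) (A.extend ans k h w) ∂D := by
        rw [integral_prod _ hint]; rfl

end OracleAlgorithm

/-! ### The information inequality for stopped algorithms -/

/-- The chord bound for `exp` on `[0, l]`. -/
lemma mul_le_log_one_add {l x : ℝ} (hx0 : 0 ≤ x) (hx1 : x ≤ 1) :
    l * x ≤ Real.log (1 + (Real.exp l - 1) * x) := by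
  have h := convexOn_exp.2 (Set.mem_univ l) (Set.mem_univ 0) hx0 (sub_nonneg.2 hx1)
    (by ring)
  simp only [smul_eq_mul, mul_zero, add_zero, Real.exp_zero, mul_one] at h
  have h' : Real.exp (x * l) ≤ 1 + (Real.exp l - 1) * x := by linarith
  calc l * x = Real.log (Real.exp (x * l)) := by rw [Real.log_exp, mul_comm]
    _ ≤ _ := Real.log_le_log (Real.exp_pos _) h'

/-- Jensen's inequality for the exponential function, in logarithmic form. -/
lemma integral_le_log_integral_exp {X : Type*} [MeasurableSpace X] {μ : Measure X}
    [IsProbabilityMeasure μ] {f : X → ℝ} (hf : Integrable f μ)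
    (hexp : Integrable (fun x => Real.exp (f x)) μ) :
    ∫ x, f x ∂μ ≤ Real.log (∫ x, Real.exp (f x) ∂μ) := by
  have h : Real.exp (∫ x, f x ∂μ) ≤ ∫ x, Real.exp (f x) ∂μ :=
    convexOn_exp.map_integral_le Real.continuous_exp.continuousOn isClosed_univ
      (.of_forall fun _ => Set.mem_univ _) hf hexp
  exact (Real.le_log_iff_exp_le ((Real.exp_pos _).trans_le h)).2 h

lemma log_one_add_mem_Icc {l x : ℝ} (hl : 0 ≤ l) (hx0 : 0 ≤ x) (hx1 : x ≤ 1) :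
    Real.log (1 + (Real.exp l - 1) * x) ∈ Set.Icc 0 l := by
  have he : 0 ≤ Real.exp l - 1 := sub_nonneg.2 (Real.one_le_exp hl)
  refine ⟨Real.log_nonneg (by nlinarith), ?_⟩
  rw [Real.log_le_iff_le_exp (by nlinarith)]
  nlinarith

/-- `ansP` and `ansQ` are answer maps such that the law of a single answer under `ansP` has
relative entropy at most `κ` with respect to its law under `ansQ`, whatever the query. The
relative entropy is encoded through the Donsker–Varadhan variational formula with bounded test
functions. -/
def AnswerEntropyLE {Z : Type*} [MeasurableSpace Z] (D : Measure Z) (ansP ansQ : ℝ → Z → ℝ × ℝ)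
    (κ : ℝ) : Prop :=
  ∀ (x : ℝ) (g : ℝ × ℝ → ℝ) (b : ℝ), Measurable g → (∀ y, g y ∈ Set.Icc 0 b) →
    ∫ w, g (ansP x w) ∂D ≤ κ + Real.log (∫ w, Real.exp (g (ansQ x w)) ∂D)

namespace OracleAlgorithm

variable {A : OracleAlgorithm.{u}} {Z : Type*} [MeasurableSpace Z] {D : Measure Z}
  [IsProbabilityMeasure D] {ansP ansQ : ℝ → Z → ℝ × ℝ}
  {S : (k : ℕ) → Set (A.Seed × (Fin k → ℝ × ℝ))}

/-- Chain rule and data processing in one: the relative entropy of the stopped history under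
`ansP` with respect to `ansQ` is at most `κ` times the expected number of queries, and it controls
the probabilities of the event `S` through the variational formula. -/
theorem mul_meanPayoff_le (hP : Measurable (fun p : ℝ × Z => ansP p.1 p.2))
    (hQ : Measurable (fun p : ℝ × Z => ansQ p.1 p.2)) (hS : ∀ k, MeasurableSet (S k))
    {κ : ℝ} (hκ : 0 ≤ κ) (hPQ : AnswerEntropyLE D ansP ansQ κ) {l : ℝ} (hl : 0 ≤ l) (m k : ℕ)
    (h : A.Seed × (Fin k → ℝ × ℝ)) :
    l * A.meanPayoff ansP 0 S D m k h ≤ κ * A.meanPayoff ansP 1 (fun _ => ∅) D m k h +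
      Real.log (1 + (Real.exp l - 1) * A.meanPayoff ansQ 0 S D m k h) := by
  have he : 0 ≤ Real.exp l - 1 := sub_nonneg.2 (Real.one_le_exp hl)
  have hmem : ∀ {ans : ℝ → Z → ℝ × ℝ}, Measurable (fun p : ℝ × Z => ans p.1 p.2) →
      ∀ m k h, A.meanPayoff ans 0 S D m k h ∈ Set.Icc 0 1 := fun hans m k h => by
    simpa using meanPayoff_mem_Icc hans hS le_rfl m k h
  have hhalt : ∀ {m k : ℕ} {h : A.Seed × (Fin k → ℝ × ℝ)}, h ∈ A.halt k →
      l * A.meanPayoff ansP 0 S D m k h ≤ κ * A.meanPayoff ansP 1 (fun _ => ∅) D m k h +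
        Real.log (1 + (Real.exp l - 1) * A.meanPayoff ansQ 0 S D m k h) := fun {m k h} hh => by
    have h1 := hmem hQ m k h
    have h2 := (meanPayoff_mem_Icc (D := D) (A := A) hP (fun _ => MeasurableSet.empty)
      zero_le_one m k h).1
    rw [meanPayoff_of_mem_halt hh] at h1 ⊢
    rw [meanPayoff_of_mem_halt (ans := ansQ) hh]
    have h3 := mul_le_log_one_add (l := l) h1.1 h1.2
    have h4 : 0 ≤ κ * A.meanPayoff ansP 1 (fun _ => ∅) D m k h := mul_nonneg hκ h2
    linarith
  induction m generalizing k with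
  | zero =>
    by_cases hh : h ∈ A.halt k
    · exact hhalt hh
    · simp [meanPayoff_zero_of_notMem_halt hh]
  | succ m ih =>
    by_cases hh : h ∈ A.halt k
    · exact hhalt hh
    · rw [meanPayoff_succ_of_notMem_halt hP hS le_rfl hh,
        meanPayoff_succ_of_notMem_halt hQ hS le_rfl hh,
        meanPayoff_succ_of_notMem_halt hP (fun _ => MeasurableSet.empty) zero_le_one hh]
      have hext : ∀ {ans : ℝ → Z → ℝ × ℝ}, Measurable (fun p : ℝ × Z => ans p.1 p.2) →
          Measurable (fun w => A.extend ans k h w) := fun hans =>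
        (measurable_extend hans k).comp measurable_prodMk_left
      -- the test function for the variational formula, as a function of the next answer
      let g : ℝ × ℝ → ℝ := fun y => Real.log (1 + (Real.exp l - 1) *
        A.meanPayoff ansQ 0 S D m (k + 1) (h.1, Fin.snoc (α := fun _ => ℝ × ℝ) h.2 y))
      have hg : Measurable g := by
        refine Real.measurable_log.comp (measurable_const.add (measurable_const.mul
          ((measurable_meanPayoff hQ hS m (k + 1)).comp (measurable_const.prodMk ?_))))
        exact (measurable_snoc k).comp measurable_prodMk_left
      have hgmem : ∀ y, g y ∈ Set.Icc 0 l := fun y =>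
        log_one_add_mem_Icc hl (hmem hQ m (k + 1) _).1 (hmem hQ m (k + 1) _).2
      have hgexp : ∀ w, Real.exp (g (ansQ (A.query k h) w)) = 1 + (Real.exp l - 1) *
          A.meanPayoff ansQ 0 S D m (k + 1) (A.extend ansQ k h w) := fun w =>
        Real.exp_log (by
          have := (hmem hQ m (k + 1) (A.extend ansQ k h w)).1
          have := mul_nonneg he this
          exact add_pos_of_pos_of_nonneg one_pos this)
      have key := hPQ (A.query k h) g l hg hgmem
      have iP : Integrable (fun w =>
          A.meanPayoff ansP 0 S D m (k + 1) (A.extend ansP k h w)) D :=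
        integrable_of_measurable_bounded
          ((measurable_meanPayoff hP hS m (k + 1)).comp (hext hP)) (fun w => hmem hP _ _ _)
      have iT : Integrable (fun w =>
          A.meanPayoff ansP 1 (fun _ => ∅) D m (k + 1) (A.extend ansP k h w)) D :=
        integrable_of_measurable_bounded
          ((measurable_meanPayoff hP (fun _ => MeasurableSet.empty) m (k + 1)).comp (hext hP))
          (fun w => meanPayoff_mem_Icc hP (fun _ => MeasurableSet.empty) zero_le_one _ _ _)
      have iQ : Integrable (fun w =>
          A.meanPayoff ansQ 0 S D m (k + 1) (A.extend ansQ k h w)) D :=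
        integrable_of_measurable_bounded
          ((measurable_meanPayoff hQ hS m (k + 1)).comp (hext hQ)) (fun w => hmem hQ _ _ _)
      have iG : Integrable (fun w => g (ansP (A.query k h) w)) D :=
        integrable_of_measurable_bounded (hg.comp (hP.comp measurable_prodMk_left))
          (fun w => hgmem _)
      have hmono : ∫ w, l * A.meanPayoff ansP 0 S D m (k + 1) (A.extend ansP k h w) ∂D ≤
          ∫ w, (κ * A.meanPayoff ansP 1 (fun _ => ∅) D m (k + 1) (A.extend ansP k h w) +
            g (ansP (A.query k h) w)) ∂D :=
        integral_mono (iP.const_mul _) ((iT.const_mul _).add iG) (fun w => ih (k + 1) _)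
      rw [integral_const_mul, integral_add (iT.const_mul _) iG, integral_const_mul] at hmono
      simp only [hgexp] at key
      rw [integral_add (integrable_const _) (iQ.const_mul _), integral_const_mul] at key
      simp only [integral_const, probReal_univ, one_smul] at key
      rw [zero_add, zero_add]
      linarith

/-- The information inequality averaged over the seed. -/
theorem mul_integral_meanPayoff_le (hP : Measurable (fun p : ℝ × Z => ansP p.1 p.2))
    (hQ : Measurable (fun p : ℝ × Z => ansQ p.1 p.2)) (hS : ∀ k, MeasurableSet (S k))
    {κ : ℝ} (hκ : 0 ≤ κ) (hPQ : AnswerEntropyLE D ansP ansQ κ) {l : ℝ} (hl : 0 ≤ l) (m : ℕ) :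
    l * ∫ s, A.meanPayoff ansP 0 S D m 0 (s, Fin.elim0) ∂A.seedLaw ≤
      κ * ∫ s, A.meanPayoff ansP 1 (fun _ => ∅) D m 0 (s, Fin.elim0) ∂A.seedLaw +
        Real.log (1 + (Real.exp l - 1) *
          ∫ s, A.meanPayoff ansQ 0 S D m 0 (s, Fin.elim0) ∂A.seedLaw) := by
  have he : 0 ≤ Real.exp l - 1 := sub_nonneg.2 (Real.one_le_exp hl)
  have hmem : ∀ {ans : ℝ → Z → ℝ × ℝ}, Measurable (fun p : ℝ × Z => ans p.1 p.2) →
      ∀ m k h, A.meanPayoff ans 0 S D m k h ∈ Set.Icc 0 1 := fun hans m k h => by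
    simpa using meanPayoff_mem_Icc hans hS le_rfl m k h
  have hs : Measurable (fun s : A.Seed => ((s, Fin.elim0) : A.Seed × (Fin 0 → ℝ × ℝ))) :=
    measurable_id.prodMk measurable_const
  have mQ : Measurable (fun s => A.meanPayoff ansQ 0 S D m 0 (s, Fin.elim0)) :=
    (measurable_meanPayoff hQ hS m 0).comp hs
  have iP : Integrable (fun s => A.meanPayoff ansP 0 S D m 0 (s, Fin.elim0)) A.seedLaw :=
    integrable_of_measurable_bounded ((measurable_meanPayoff hP hS m 0).comp hs)
      (fun s => hmem hP _ _ _)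
  have iQ : Integrable (fun s => A.meanPayoff ansQ 0 S D m 0 (s, Fin.elim0)) A.seedLaw :=
    integrable_of_measurable_bounded mQ (fun s => hmem hQ _ _ _)
  have iT : Integrable (fun s => A.meanPayoff ansP 1 (fun _ => ∅) D m 0 (s, Fin.elim0))
      A.seedLaw :=
    integrable_of_measurable_bounded
      ((measurable_meanPayoff hP (fun _ => MeasurableSet.empty) m 0).comp hs)
      (fun s => meanPayoff_mem_Icc hP (fun _ => MeasurableSet.empty) zero_le_one _ _ _)
  have iL : Integrable (fun s => Real.log (1 + (Real.exp l - 1) *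
      A.meanPayoff ansQ 0 S D m 0 (s, Fin.elim0))) A.seedLaw :=
    integrable_of_measurable_bounded
      (Real.measurable_log.comp (measurable_const.add (measurable_const.mul mQ)))
      (fun s => log_one_add_mem_Icc hl (hmem hQ _ _ _).1 (hmem hQ _ _ _).2)
  have hexp : ∀ s, Real.exp (Real.log (1 + (Real.exp l - 1) *
      A.meanPayoff ansQ 0 S D m 0 (s, Fin.elim0))) = 1 + (Real.exp l - 1) *
      A.meanPayoff ansQ 0 S D m 0 (s, Fin.elim0) := fun s =>
    Real.exp_log (add_pos_of_pos_of_nonneg one_pos (mul_nonneg he (hmem hQ _ _ _).1))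
  have jensen := integral_le_log_integral_exp iL (by
    simp only [hexp]
    exact (integrable_const _).add (iQ.const_mul _))
  simp only [hexp] at jensen
  rw [integral_add (integrable_const _) (iQ.const_mul _), integral_const_mul] at jensen
  simp only [integral_const, probReal_univ, one_smul] at jensen
  have hmono := integral_mono (iP.const_mul l) ((iT.const_mul κ).add iL)
    (fun s => mul_meanPayoff_le hP hQ hS hκ hPQ hl m 0 (s, Fin.elim0))
  rw [integral_const_mul] at hmono
  simp only [Pi.add_apply] at hmono
  rw [integral_add (iT.const_mul _) iL, integral_const_mul] at hmono
  linarith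

end OracleAlgorithm

/-! ### Payoffs and the run of an algorithm -/

namespace OracleAlgorithm

variable {A : OracleAlgorithm.{u}} {F : ℝ → ℝ} {σ : ℝ} {O : StochasticOracle F σ}

variable (A O) in
/-- The event that the algorithm halts and returns a point of `G`. -/
def outputEvent (G : Set ℝ) : Set (A.Seed × (ℕ → O.Z)) :=
  {ω | ∃ n : ℕ, A.HaltsAt O ω.1 ω.2 n ∧ (∀ m < n, ¬ A.HaltsAt O ω.1 ω.2 m) ∧
    A.output n (ω.1, A.answers O ω.1 ω.2 n) ∈ G}

lemma payoff_one_le_of_haltsAt (s : A.Seed) (z : ℕ → O.Z) {n : ℕ} (hn : A.HaltsAt O s z n)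
    {m k : ℕ} (hk : k ≤ n) :
    A.payoff O.answer 1 (fun _ => ∅) m k (s, A.answers O s z k) z ≤ (n : ℝ) - k := by
  have hkn : (k : ℝ) ≤ n := by exact_mod_cast hk
  induction m generalizing k with
  | zero =>
    by_cases hh : (s, A.answers O s z k) ∈ A.halt k
    · rw [payoff_of_mem_halt hh]; simpa using hkn
    · rw [payoff_zero_of_notMem_halt hh]; simpa using hkn
  | succ m ih =>
    by_cases hh : (s, A.answers O s z k) ∈ A.halt k
    · rw [payoff_of_mem_halt hh]; simpa using hkn
    · rw [payoff_succ_of_notMem_halt hh]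
      have hlt : k < n := lt_of_le_of_ne hk (by rintro rfl; exact hh hn)
      have hlt' : ((k + 1 : ℕ) : ℝ) ≤ n := by exact_mod_cast hlt
      have := ih hlt hlt'
      push_cast at this
      change 1 + A.payoff O.answer 1 (fun _ => ∅) m (k + 1) (s, A.answers O s z (k + 1)) z ≤ _
      linarith

lemma ofReal_payoff_le_numQueries (s : A.Seed) (z : ℕ → O.Z) (m : ℕ) :
    ENNReal.ofReal (A.payoff O.answer 1 (fun _ => ∅) m 0 (s, Fin.elim0) z) ≤
      A.numQueries O s z := by
  refine le_iInf₂ fun n hn => ?_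
  rw [← ENNReal.ofReal_natCast]
  refine ENNReal.ofReal_le_ofReal ?_
  have h := payoff_one_le_of_haltsAt s z hn (m := m) n.zero_le
  rwa [Nat.cast_zero, sub_zero] at h

lemma payoff_zero_eq_one (s : A.Seed) (z : ℕ → O.Z) {G : Set ℝ} {n : ℕ}
    (hn : A.HaltsAt O s z n) (hlt : ∀ j < n, ¬ A.HaltsAt O s z j)
    (hout : A.output n (s, A.answers O s z n) ∈ G) {m k : ℕ} (hk : k ≤ n) (hm : n ≤ k + m) :
    A.payoff O.answer 0 (fun k => A.output k ⁻¹' G) m k (s, A.answers O s z k) z = 1 := by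
  induction m generalizing k with
  | zero =>
    obtain rfl : k = n := le_antisymm hk hm
    rw [payoff_of_mem_halt hn]
    exact Set.indicator_of_mem (s := A.output k ⁻¹' G) hout _
  | succ m ih =>
    rcases hk.eq_or_lt with rfl | hkn
    · rw [payoff_of_mem_halt hn]
      exact Set.indicator_of_mem (s := A.output k ⁻¹' G) hout _
    · rw [payoff_succ_of_notMem_halt (hlt k hkn), zero_add]
      exact ih hkn (by omega)

lemma payoff_zero_eq_zero (s : A.Seed) (z : ℕ → O.Z) {G : Set ℝ}
    (h : (s, z) ∉ A.outputEvent O G) {m k : ℕ} (hlt : ∀ j < k, ¬ A.HaltsAt O s z j) :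
    A.payoff O.answer 0 (fun k => A.output k ⁻¹' G) m k (s, A.answers O s z k) z = 0 := by
  have hhalt : ∀ {m k : ℕ}, (∀ j < k, ¬ A.HaltsAt O s z j) →
      (s, A.answers O s z k) ∈ A.halt k →
      A.payoff O.answer 0 (fun k => A.output k ⁻¹' G) m k (s, A.answers O s z k) z = 0 := by
    intro m k hlt hh
    rw [payoff_of_mem_halt hh]
    exact Set.indicator_of_notMem (s := A.output k ⁻¹' G) (fun hout => h ⟨k, hh, hlt, hout⟩) _
  induction m generalizing k with
  | zero =>
    by_cases hh : (s, A.answers O s z k) ∈ A.halt k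
    · exact hhalt hlt hh
    · rw [payoff_zero_of_notMem_halt hh]
  | succ m ih =>
    by_cases hh : (s, A.answers O s z k) ∈ A.halt k
    · exact hhalt hlt hh
    · rw [payoff_succ_of_notMem_halt hh, zero_add]
      refine ih (k := k + 1) fun j hj => ?_
      rcases Nat.lt_succ_iff_lt_or_eq.1 hj with hj | rfl
      · exact hlt j hj
      · exact hh

lemma measurable_answers (hO : Measurable (fun p : ℝ × O.Z => O.answer p.1 p.2)) (n : ℕ) :
    Measurable (fun ω : A.Seed × (ℕ → O.Z) => A.answers O ω.1 ω.2 n) := by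
  induction n with
  | zero => exact measurable_const
  | succ n ih =>
    refine (measurable_snoc n).comp (ih.prodMk (hO.comp (Measurable.prodMk ?_ ?_)))
    · exact (A.measurable_query n).comp (measurable_fst.prodMk ih)
    · exact (measurable_pi_apply n).comp measurable_snd

lemma measurableSet_haltsAt (hO : Measurable (fun p : ℝ × O.Z => O.answer p.1 p.2)) (n : ℕ) :
    MeasurableSet {ω : A.Seed × (ℕ → O.Z) | A.HaltsAt O ω.1 ω.2 n} :=
  (measurable_fst.prodMk (measurable_answers hO n)) (A.measurableSet_halt n)

lemma measurableSet_outputEvent (hO : Measurable (fun p : ℝ × O.Z => O.answer p.1 p.2))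
    {G : Set ℝ} (hG : MeasurableSet G) : MeasurableSet (A.outputEvent O G) := by
  have : A.outputEvent O G = ⋃ n, ({ω | A.HaltsAt O ω.1 ω.2 n} ∩
      ((⋂ m, ⋂ (_ : m < n), {ω | A.HaltsAt O ω.1 ω.2 m}ᶜ) ∩
        {ω | A.output n (ω.1, A.answers O ω.1 ω.2 n) ∈ G})) := by
    ext ω
    simp [outputEvent]
  rw [this]
  refine MeasurableSet.iUnion fun n => (measurableSet_haltsAt hO n).inter
    ((MeasurableSet.iInter fun m => MeasurableSet.iInter fun _ =>
      (measurableSet_haltsAt hO m).compl).inter ?_)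
  exact ((A.measurable_output n).comp (measurable_fst.prodMk (measurable_answers hO n))) hG

instance : IsProbabilityMeasure (A.runLaw O) := by
  unfold runLaw
  infer_instance

lemma integral_meanPayoff_eq (hO : Measurable (fun p : ℝ × O.Z => O.answer p.1 p.2))
    {c : ℝ} (hc : 0 ≤ c) {S : (k : ℕ) → Set (A.Seed × (Fin k → ℝ × ℝ))}
    (hS : ∀ k, MeasurableSet (S k)) (m : ℕ) :
    Integrable (fun ω => A.payoff O.answer c S m 0 (ω.1, Fin.elim0) ω.2) (A.runLaw O) ∧
    ∫ s, A.meanPayoff O.answer c S O.D m 0 (s, Fin.elim0) ∂A.seedLaw =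
      ∫ ω, A.payoff O.answer c S m 0 (ω.1, Fin.elim0) ω.2 ∂(A.runLaw O) := by
  have hmeas : Measurable (fun ω : A.Seed × (ℕ → O.Z) =>
      A.payoff O.answer c S m 0 (ω.1, Fin.elim0) ω.2) :=
    (measurable_payoff hO hS m 0).comp
      ((measurable_fst.prodMk measurable_const).prodMk measurable_snd)
  have hint : Integrable (fun ω => A.payoff O.answer c S m 0 (ω.1, Fin.elim0) ω.2) (A.runLaw O) :=
    integrable_of_measurable_bounded hmeas
      (fun ω => ⟨payoff_nonneg hc _ _ _ _, payoff_le hc _ _ _ _⟩)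
  refine ⟨hint, ?_⟩
  unfold runLaw at hint ⊢
  rw [integral_prod _ hint]
  rfl

lemma integral_meanPayoff_one_le (hO : Measurable (fun p : ℝ × O.Z => O.answer p.1 p.2))
    (hfin : A.expectedQueries O ≠ ⊤) (m : ℕ) :
    ∫ s, A.meanPayoff O.answer 1 (fun _ => ∅) O.D m 0 (s, Fin.elim0) ∂A.seedLaw ≤
      (A.expectedQueries O).toReal := by
  obtain ⟨hint, heq⟩ := integral_meanPayoff_eq (A := A) hO zero_le_one
    (S := fun _ => ∅) (fun _ => MeasurableSet.empty) m
  rw [heq, integral_eq_lintegral_of_nonneg_ae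
    (.of_forall fun ω => payoff_nonneg zero_le_one _ _ _ _) hint.aestronglyMeasurable]
  exact ENNReal.toReal_mono hfin
    (lintegral_mono fun ω => ofReal_payoff_le_numQueries ω.1 ω.2 m)

lemma tendsto_integral_meanPayoff (hO : Measurable (fun p : ℝ × O.Z => O.answer p.1 p.2))
    {G : Set ℝ} (hG : MeasurableSet G) :
    Tendsto (fun m => ∫ s, A.meanPayoff O.answer 0 (fun k => A.output k ⁻¹' G) O.D m 0
      (s, Fin.elim0) ∂A.seedLaw) atTop (𝓝 ((A.runLaw O).real (A.outputEvent O G))) := by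
  have hS : ∀ k, MeasurableSet (A.output k ⁻¹' G) := fun k => A.measurable_output k hG
  have hE := measurableSet_outputEvent (A := A) hO hG
  rw [← integral_indicator_one hE]
  simp only [fun m => (integral_meanPayoff_eq hO le_rfl hS m).2]
  refine tendsto_integral_of_dominated_convergence (fun _ => 1)
    (fun m => (integral_meanPayoff_eq hO le_rfl hS m).1.aestronglyMeasurable)
    (integrable_const _) (fun m => .of_forall fun ω => ?_) (.of_forall fun ω => ?_)
  · rw [Real.norm_of_nonneg (payoff_nonneg le_rfl _ _ _ _)]
    simpa using payoff_le (S := fun k => A.output k ⁻¹' G) (ans := O.answer) le_rfl m 0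
      (ω.1, Fin.elim0) ω.2
  · refine tendsto_const_nhds.congr' ?_
    by_cases hω : ω ∈ A.outputEvent O G
    · obtain ⟨n, hn, hlt, hout⟩ := hω
      filter_upwards [eventually_ge_atTop n] with m hm
      rw [Set.indicator_of_mem (show ω ∈ A.outputEvent O G from ⟨n, hn, hlt, hout⟩)]
      exact (payoff_zero_eq_one ω.1 ω.2 hn hlt hout n.zero_le (by omega)).symm
    · filter_upwards with m
      rw [Set.indicator_of_notMem hω]
      exact (payoff_zero_eq_zero ω.1 ω.2 hω (k := 0) (by simp)).symm

/-- A run returns at most one point, so disjoint targets are hit with total probability at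
most one. -/
lemma sum_outputEvent_le_one (hO : Measurable (fun p : ℝ × O.Z => O.answer p.1 p.2))
    {ι : Type*} [Fintype ι] {G : ι → Set ℝ} (hG : ∀ i, MeasurableSet (G i))
    (hdisj : Pairwise fun i j => Disjoint (G i) (G j)) :
    ∑ i, (A.runLaw O).real (A.outputEvent O (G i)) ≤ 1 := by
  rw [← measureReal_biUnion_finset (fun i _ j _ hij => ?_)
    (fun i _ => measurableSet_outputEvent hO (hG i))]
  · exact measureReal_le_one
  · refine Set.disjoint_left.2 ?_
    rintro ω ⟨n, hn, hlt, hout⟩ ⟨n', hn', hlt', hout'⟩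
    obtain rfl : n = n' := le_antisymm (not_lt.1 fun h => hlt _ h hn')
      (not_lt.1 fun h => hlt' _ h hn)
    exact Set.disjoint_left.1 (hdisj hij) hout hout'

end OracleAlgorithm

/-! ### Gaussian noise and its shifts -/

lemma log_integral_exp_mem_Icc {X : Type*} [MeasurableSpace X] {μ : Measure X}
    [IsProbabilityMeasure μ] {g : X → ℝ} (hg : Measurable g) {b : ℝ}
    (hgb : ∀ x, g x ∈ Set.Icc 0 b) : Real.log (∫ x, Real.exp (g x) ∂μ) ∈ Set.Icc 0 b := by
  have hint : Integrable (fun x => Real.exp (g x)) μ :=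
    Integrable.of_mem_Icc 1 (Real.exp b) (Real.measurable_exp.comp hg).aemeasurable
      (.of_forall fun x => ⟨Real.one_le_exp (hgb x).1, Real.exp_le_exp.2 (hgb x).2⟩)
  have h1 : 1 ≤ ∫ x, Real.exp (g x) ∂μ := by
    simpa using integral_mono (integrable_const (1 : ℝ)) hint
      (fun x => Real.one_le_exp (hgb x).1)
  have h2 : ∫ x, Real.exp (g x) ∂μ ≤ Real.exp b := by
    simpa using integral_mono hint (integrable_const (Real.exp b))
      (fun x => Real.exp_le_exp.2 (hgb x).2)
  exact ⟨Real.log_nonneg h1, (Real.log_le_iff_le_exp (by linarith)).2 h2⟩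

lemma gaussianPDFReal_add_eq_mul {v : ℝ≥0} (hv : v ≠ 0) (a x : ℝ) :
    gaussianPDFReal 0 v (x + a) =
      gaussianPDFReal 0 v x * Real.exp (-(a / v) * x - a ^ 2 / (2 * v)) := by
  have hv' : (v : ℝ) ≠ 0 := by exact_mod_cast hv
  rw [gaussianPDFReal, gaussianPDFReal,
    mul_assoc (√(2 * Real.pi * v))⁻¹, ← Real.exp_add]
  congr 2
  field_simp
  ring

/-- Variational bound for the relative entropy `a ^ 2 / (2 v)` of the shift by `a` of a centred
Gaussian. -/
lemma integral_shift_gaussianReal_le {v : ℝ≥0} (hv : v ≠ 0) (a : ℝ) {g : ℝ → ℝ} {b : ℝ}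
    (hg : Measurable g) (hgb : ∀ x, g x ∈ Set.Icc 0 b) :
    ∫ x, g (x + a) ∂(gaussianReal 0 v) ≤
      a ^ 2 / (2 * v) + Real.log (∫ x, Real.exp (g x) ∂(gaussianReal 0 v)) := by
  have hchange : ∫ x, Real.exp (g x) ∂(gaussianReal 0 v) =
      ∫ x, Real.exp (g (x + a) + (-(a / v) * x - a ^ 2 / (2 * v))) ∂(gaussianReal 0 v) := by
    rw [integral_gaussianReal_eq_integral_smul hv, integral_gaussianReal_eq_integral_smul hv,
      ← integral_add_right_eq_self _ a]
    refine integral_congr_ae (.of_forall fun x => ?_)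
    simp only [smul_eq_mul, gaussianPDFReal_add_eq_mul hv a x, Real.exp_add (g (x + a))]
    ring
  have hgm : Measurable (fun x => g (x + a)) := hg.comp (measurable_id.add_const a)
  have ig : Integrable (fun x => g (x + a)) (gaussianReal 0 v) :=
    Integrable.of_mem_Icc 0 b hgm.aemeasurable (.of_forall fun x => hgb _)
  have iid : Integrable (fun x : ℝ => x) (gaussianReal 0 v) :=
    (memLp_id_gaussianReal 1).integrable (by simp)
  have ilin : Integrable (fun x : ℝ => -(a / v) * x - a ^ 2 / (2 * v)) (gaussianReal 0 v) :=
    (iid.const_mul _).sub (integrable_const _)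
  have iexp : Integrable (fun x => Real.exp (g (x + a) + (-(a / v) * x - a ^ 2 / (2 * v))))
      (gaussianReal 0 v) := by
    have i1 : Integrable (fun x : ℝ => Real.exp (-(a / v) * x)) (gaussianReal 0 v) :=
      integrable_exp_mul_gaussianReal _
    refine (i1.const_mul (Real.exp b * Real.exp (-(a ^ 2 / (2 * v))))).mono'
      (Real.measurable_exp.comp (hgm.add (by fun_prop))).aestronglyMeasurable
      (.of_forall fun x => ?_)
    rw [Real.norm_of_nonneg (Real.exp_pos _).le, ← Real.exp_add, ← Real.exp_add]
    exact Real.exp_le_exp.2 (by linarith [(hgb (x + a)).2])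
  have jensen := integral_le_log_integral_exp (ig.add ilin) iexp
  simp only [Pi.add_apply] at jensen
  rw [integral_add ig ilin, integral_sub (iid.const_mul _) (integrable_const _),
    integral_const_mul, integral_id_gaussianReal, ← hchange] at jensen
  simp only [integral_const, probReal_univ, one_smul, mul_zero, zero_sub] at jensen
  linarith

/-- The variational bound for the shift of a pair of independent centred Gaussians. -/
lemma integral_shift_prod_gaussianReal_le {v w : ℝ≥0} (hv : v ≠ 0) (hw : w ≠ 0) (a c : ℝ)
    {g : ℝ × ℝ → ℝ} {b : ℝ} (hg : Measurable g) (hgb : ∀ x, g x ∈ Set.Icc 0 b) :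
    ∫ z, g (z.1 + a, z.2 + c) ∂((gaussianReal 0 v).prod (gaussianReal 0 w)) ≤
      a ^ 2 / (2 * v) + c ^ 2 / (2 * w) +
        Real.log (∫ z, Real.exp (g z) ∂((gaussianReal 0 v).prod (gaussianReal 0 w))) := by
  have hgy : ∀ y, Measurable (fun x => g (x, y)) := fun y => hg.comp measurable_prodMk_right
  have hgs : Measurable (fun z : ℝ × ℝ => g (z.1 + a, z.2 + c)) :=
    hg.comp ((measurable_fst.add_const a).prodMk (measurable_snd.add_const c))
  have hge : Measurable (fun z : ℝ × ℝ => Real.exp (g z)) := Real.measurable_exp.comp hg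
  have is : Integrable (fun z : ℝ × ℝ => g (z.1 + a, z.2 + c))
      ((gaussianReal 0 v).prod (gaussianReal 0 w)) :=
    Integrable.of_mem_Icc 0 b hgs.aemeasurable (.of_forall fun x => hgb _)
  have ie : Integrable (fun z : ℝ × ℝ => Real.exp (g z))
      ((gaussianReal 0 v).prod (gaussianReal 0 w)) :=
    Integrable.of_mem_Icc 1 (Real.exp b) hge.aemeasurable
      (.of_forall fun x => ⟨Real.one_le_exp (hgb x).1, Real.exp_le_exp.2 (hgb x).2⟩)
  -- partial log-moment generating function, with the first coordinate integrated out
  let L : ℝ → ℝ := fun y => Real.log (∫ x, Real.exp (g (x, y)) ∂(gaussianReal 0 v))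
  have hL : Measurable L :=
    Real.measurable_log.comp hge.stronglyMeasurable.integral_prod_left'.measurable
  have hLb : ∀ y, L y ∈ Set.Icc 0 b := fun y => log_integral_exp_mem_Icc (hgy y) (fun x => hgb _)
  have hLexp : ∀ y, Real.exp (L y) = ∫ x, Real.exp (g (x, y)) ∂(gaussianReal 0 v) := fun y => by
    refine Real.exp_log (integral_exp_pos ?_)
    exact Integrable.of_mem_Icc 1 (Real.exp b) (Real.measurable_exp.comp (hgy y)).aemeasurable
      (.of_forall fun x => ⟨Real.one_le_exp (hgb _).1, Real.exp_le_exp.2 (hgb _).2⟩)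
  have iL : Integrable (fun y => L (y + c)) (gaussianReal 0 w) :=
    Integrable.of_mem_Icc 0 b (hL.comp (measurable_id.add_const c)).aemeasurable
      (.of_forall fun x => hLb _)
  have h1 : ∫ y, ∫ x, g (x + a, y + c) ∂(gaussianReal 0 v) ∂(gaussianReal 0 w) ≤
      ∫ y, (a ^ 2 / (2 * v) + L (y + c)) ∂(gaussianReal 0 w) :=
    integral_mono is.integral_prod_right ((integrable_const _).add iL)
      (fun y => integral_shift_gaussianReal_le hv a (hgy (y + c)) (fun x => hgb _))
  have h2 := integral_shift_gaussianReal_le hw c hL hLb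
  rw [integral_add (integrable_const _) iL] at h1
  simp only [integral_const, probReal_univ, one_smul] at h1
  rw [integral_prod_symm _ is, integral_prod_symm _ ie]
  simp only [hLexp] at h2
  linarith

/-! ### The Gaussian oracle -/

/-- The law of the noise variable `(z₁, z₂)`: independent centred Gaussians, the first of
variance `v` and the second of variance `σ ^ 2`. -/
noncomputable def noiseLaw (v : ℝ≥0) (σ : ℝ) : Measure (ℝ × ℝ) :=
  (gaussianReal 0 v).prod (gaussianReal 0 (σ ^ 2).toNNReal)

instance (v : ℝ≥0) (σ : ℝ) : IsProbabilityMeasure (noiseLaw v σ) := by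
  unfold noiseLaw
  infer_instance

lemma deriv_add_noise {F : ℝ → ℝ} (hF : Differentiable ℝ F) (x₀ : ℝ) (z : ℝ × ℝ) (x : ℝ) :
    HasDerivAt (fun y => F y + z.1 + z.2 * (y - x₀)) (deriv F x + z.2) x := by
  have h := ((hF x).hasDerivAt.add_const z.1).add
    (((hasDerivAt_id x).sub_const x₀).const_mul z.2)
  simp only [id, mul_one] at h
  exact h

lemma integrable_noiseLaw_fst (v : ℝ≥0) (σ : ℝ) :
    Integrable (fun z : ℝ × ℝ => z.1) (noiseLaw v σ) :=
  Integrable.comp_fst (f := fun x : ℝ => x) ((memLp_id_gaussianReal 1).integrable (by simp)) _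

lemma integrable_noiseLaw_snd (v : ℝ≥0) (σ : ℝ) :
    Integrable (fun z : ℝ × ℝ => z.2) (noiseLaw v σ) :=
  Integrable.comp_snd (f := fun x : ℝ => x) ((memLp_id_gaussianReal 1).integrable (by simp)) _

/-- The oracle that perturbs `F` by a random affine function `z₁ + z₂ (x - x₀)`. The gradient
noise `z₂` has variance `σ ^ 2`; the variance `v` of the noise `z₁` of the function value is not
restricted and is used to mask the function values. -/
noncomputable def gaussianOracle (F : ℝ → ℝ) (hF : Differentiable ℝ F) (x₀ σ : ℝ) (v : ℝ≥0) :
    StochasticOracle F σ where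
  Z := ℝ × ℝ
  D := noiseLaw v σ
  f x z := F x + z.1 + z.2 * (x - x₀)
  measurable_f := by
    have := hF.continuous.measurable
    fun_prop
  differentiable_f z x := (deriv_add_noise hF x₀ z x).differentiableAt
  integrable_f x := ((integrable_const _).add (integrable_noiseLaw_fst v σ)).add
    ((integrable_noiseLaw_snd v σ).mul_const _)
  mean_f x := by
    have i1 : Integrable (fun z : ℝ × ℝ => F x + z.1) (noiseLaw v σ) :=
      (integrable_const _).add (integrable_noiseLaw_fst v σ)
    have i2 : Integrable (fun z : ℝ × ℝ => z.2 * (x - x₀)) (noiseLaw v σ) :=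
      (integrable_noiseLaw_snd v σ).mul_const _
    rw [integral_add i1 i2, integral_add (integrable_const _) (integrable_noiseLaw_fst v σ),
      integral_mul_const]
    have h1 : ∫ z, z.1 ∂(noiseLaw v σ) = 0 := by
      unfold noiseLaw
      rw [integral_fun_fst (f := fun x : ℝ => x)]
      simp
    have h2 : ∫ z, z.2 ∂(noiseLaw v σ) = 0 := by
      unfold noiseLaw
      rw [integral_fun_snd (f := fun x : ℝ => x)]
      simp
    simp [h1, h2]
  variance_le x := by
    simp only [fun z => (deriv_add_noise hF x₀ z x).deriv, add_sub_cancel_left]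
    have hm : Measurable (fun y : ℝ => ENNReal.ofReal (y ^ 2)) := by fun_prop
    have h1 : ∫⁻ z, ENNReal.ofReal (z.2 ^ 2) ∂(noiseLaw v σ) =
        ∫⁻ y, ENNReal.ofReal (y ^ 2) ∂(gaussianReal 0 (σ ^ 2).toNNReal) :=
      measurePreserving_snd.lintegral_comp hm
    have h2 := variance_fun_id_gaussianReal (μ := 0) (v := (σ ^ 2).toNNReal)
    rw [variance_eq_integral measurable_id'.aemeasurable] at h2
    simp only [integral_id_gaussianReal, sub_zero] at h2
    have hsq : Integrable (fun y : ℝ => y ^ 2) (gaussianReal 0 (σ ^ 2).toNNReal) :=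
      (memLp_id_gaussianReal 2).integrable_sq
    rw [h1, ← ofReal_integral_eq_lintegral_ofReal hsq (.of_forall fun y => sq_nonneg y), h2,
      Real.coe_toNNReal _ (sq_nonneg σ)]

section

variable {F F₀ : ℝ → ℝ} (hF : Differentiable ℝ F) (hF₀ : Differentiable ℝ F₀) (x₀ σ : ℝ) (v : ℝ≥0)

lemma gaussianOracle_answer (x : ℝ) (z : ℝ × ℝ) :
    (gaussianOracle F hF x₀ σ v).answer x z =
      (F x + z.1 + z.2 * (x - x₀), deriv F x + z.2) :=
  Prod.ext rfl (deriv_add_noise hF x₀ z x).deriv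

lemma measurable_gaussianOracle_answer :
    Measurable (fun p : ℝ × (ℝ × ℝ) => (gaussianOracle F hF x₀ σ v).answer p.1 p.2) := by
  simp only [gaussianOracle_answer]
  have h1 := hF.continuous.measurable
  have h2 := measurable_deriv F
  fun_prop

variable {x₀ σ v}

/-- Seen through the answers, replacing `F₀` by `F` amounts to shifting the noise. -/
lemma answerEntropyLE_gaussianOracle (hv : v ≠ 0) (hσ : 0 < σ) {a b : ℝ}
    (ha : ∀ x, |F x - F₀ x - (deriv F x - deriv F₀ x) * (x - x₀)| ≤ a)
    (hb : ∀ x, |deriv F x - deriv F₀ x| ≤ b) :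
    AnswerEntropyLE (noiseLaw v σ) (gaussianOracle F hF x₀ σ v).answer
      (gaussianOracle F₀ hF₀ x₀ σ v).answer (a ^ 2 / (2 * v) + b ^ 2 / (2 * σ ^ 2)) := by
  intro x g B hg hgB
  have hw : (σ ^ 2).toNNReal ≠ 0 := (Real.toNNReal_pos.2 (by positivity)).ne'
  have hwσ : (((σ ^ 2).toNNReal : ℝ≥0) : ℝ) = σ ^ 2 := Real.coe_toNNReal _ (sq_nonneg σ)
  let g' : ℝ × ℝ → ℝ := fun z => g (F₀ x + z.1 + z.2 * (x - x₀), deriv F₀ x + z.2)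
  have hg' : Measurable g' := hg.comp (by fun_prop)
  have h := integral_shift_prod_gaussianReal_le hv hw
    (F x - F₀ x - (deriv F x - deriv F₀ x) * (x - x₀)) (deriv F x - deriv F₀ x) hg'
    (fun z => hgB _)
  have hshift : ∀ z : ℝ × ℝ, g ((gaussianOracle F hF x₀ σ v).answer x z) =
      g' (z.1 + (F x - F₀ x - (deriv F x - deriv F₀ x) * (x - x₀)),
        z.2 + (deriv F x - deriv F₀ x)) := fun z => by
    rw [gaussianOracle_answer]
    congr 2 <;> ring
  have hdef : ∀ z : ℝ × ℝ, g ((gaussianOracle F₀ hF₀ x₀ σ v).answer x z) = g' z := fun z => by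
    rw [gaussianOracle_answer]
  refine (integral_congr_ae (.of_forall hshift)).trans_le (h.trans ?_)
  have e1 := sq_le_sq' (abs_le.1 (ha x)).1 (abs_le.1 (ha x)).2
  have e2 := sq_le_sq' (abs_le.1 (hb x)).1 (abs_le.1 (hb x)).2
  have hlog : Real.log (∫ z, Real.exp (g ((gaussianOracle F₀ hF₀ x₀ σ v).answer x z))
      ∂(noiseLaw v σ)) = Real.log (∫ z, Real.exp (g' z) ∂(noiseLaw v σ)) := by
    simp only [hdef]
  rw [hlog, hwσ]
  refine add_le_add (add_le_add ?_ ?_) le_rfl <;> gcongr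

end

/-! ### Smooth convex functions with truncated linear gradient -/

lemma add_mul_sub_le_of_monotone_deriv {F f : ℝ → ℝ} (hF : ∀ x, HasDerivAt F (f x) x)
    (hf : Monotone f) (x y : ℝ) : F x + f x * (y - x) ≤ F y := by
  have hderiv : deriv F = f := funext fun x => (hF x).deriv
  have hd : Differentiable ℝ F := fun x => (hF x).differentiableAt
  have hconv : ConvexOn ℝ Set.univ F := Monotone.convexOn_univ_of_deriv hd (hderiv ▸ hf)
  rcases lt_trichotomy x y with h | rfl | h
  · have := hconv.le_slope_of_hasDerivAt (Set.mem_univ x) (Set.mem_univ y) h (hF x)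
    rw [slope_def_field, le_div_iff₀ (by linarith)] at this
    linarith
  · simp
  · have := hconv.slope_le_of_hasDerivAt (Set.mem_univ y) (Set.mem_univ x) h (hF x)
    rw [slope_def_field, div_le_iff₀ (by linarith)] at this
    linarith

/-- The slope of the Huber function: `t ↦ H t` truncated to `[-b, b]`. -/
noncomputable def huberSlope (H b t : ℝ) : ℝ := max (-b) (min b (H * t))

/-- The Huber function: quadratic with curvature `H` near `0`, and affine with slopes `±b` far
from `0`. -/
noncomputable def huber (H b t : ℝ) : ℝ := ∫ s in (0 : ℝ)..t, huberSlope H b s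

section

variable {H b : ℝ}

lemma continuous_huberSlope : Continuous (huberSlope H b) := by
  unfold huberSlope
  fun_prop

lemma hasDerivAt_huber (t : ℝ) : HasDerivAt (huber H b) (huberSlope H b t) t :=
  (continuous_huberSlope.integral_hasStrictDerivAt 0 t).hasDerivAt

lemma hasDerivAt_huber_sub (c x : ℝ) :
    HasDerivAt (fun y => huber H b (y - c)) (huberSlope H b (x - c)) x := by
  simpa using (hasDerivAt_huber (H := H) (b := b) (x - c)).comp_sub_const x c

lemma differentiable_huber_sub (c : ℝ) : Differentiable ℝ (fun y => huber H b (y - c)) :=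
  fun x => (hasDerivAt_huber_sub c x).differentiableAt

lemma deriv_huber_sub (c x : ℝ) :
    deriv (fun y => huber H b (y - c)) x = huberSlope H b (x - c) :=
  (hasDerivAt_huber_sub c x).deriv

lemma monotone_huberSlope (hH : 0 ≤ H) : Monotone (huberSlope H b) := fun _ _ h =>
  max_le_max le_rfl (min_le_min le_rfl (mul_le_mul_of_nonneg_left h hH))

lemma abs_huberSlope_le (hb : 0 ≤ b) (t : ℝ) : |huberSlope H b t| ≤ b :=
  abs_le.2 ⟨le_max_left _ _, max_le (by linarith) (min_le_left _ _)⟩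

lemma monotone_mul_sub_huberSlope (hH : 0 ≤ H) :
    Monotone (fun t => H * t - huberSlope H b t) := by
  intro s t hst
  have h : H * s ≤ H * t := mul_le_mul_of_nonneg_left hst hH
  simp only [huberSlope]
  grind

lemma huberSlope_eq_of_le (hb : 0 ≤ b) {t : ℝ} (h : b ≤ H * t) : huberSlope H b t = b := by
  rw [huberSlope, min_eq_left h, max_eq_right (by linarith)]

lemma huberSlope_eq_of_le_neg (hb : 0 ≤ b) {t : ℝ} (h : H * t ≤ -b) :
    huberSlope H b t = -b := by
  rw [huberSlope, min_eq_right (by linarith), max_eq_left h]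

lemma abs_mul_le_of_abs_huberSlope_le {ε t : ℝ} (hb : ε < b)
    (h : |huberSlope H b t| ≤ ε) : |H * t| ≤ ε := by
  rw [abs_le, huberSlope] at *
  grind

lemma isHSmooth_huber_sub (hH : 0 ≤ H) (c : ℝ) : IsHSmooth H (fun y => huber H b (y - c)) := by
  refine ⟨differentiable_huber_sub c, fun x y => ?_⟩
  rw [deriv_huber_sub]
  -- the tangent line inequality for the convex function `H / 2 * y ^ 2 - huber H b y`
  have hd : ∀ t, HasDerivAt (fun t => H / 2 * t ^ 2 - huber H b t) (H * t - huberSlope H b t) t :=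
    fun t => (((hasDerivAt_pow 2 t).const_mul (H / 2)).sub (hasDerivAt_huber t)).congr_deriv
      (by push_cast; ring)
  have h := add_mul_sub_le_of_monotone_deriv hd (monotone_mul_sub_huberSlope hH) (x - c) (y - c)
  nlinarith

lemma convexOn_huber_sub (hH : 0 ≤ H) (c : ℝ) :
    ConvexOn ℝ Set.univ (fun y => huber H b (y - c)) := by
  refine Monotone.convexOn_univ_of_deriv (differentiable_huber_sub c) fun x y hxy => ?_
  rw [deriv_huber_sub, deriv_huber_sub]
  exact monotone_huberSlope hH (by linarith)

lemma huber_sub_mem_domainBounded (hH : 0 ≤ H) (hb : 0 ≤ b) {c R x₀ : ℝ} (hc : |x₀ - c| ≤ R) :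
    (fun y => huber H b (y - c)) ∈ DomainBounded H R x₀ := by
  refine ⟨isHSmooth_huber_sub hH c, convexOn_huber_sub hH c, c, fun x => ?_, hc⟩
  have h := add_mul_sub_le_of_monotone_deriv hasDerivAt_huber
    (monotone_huberSlope (b := b) hH) 0 (x - c)
  have h0 : huberSlope H b 0 = 0 := by simp [huberSlope, hb]
  rw [h0] at h
  simpa using h

lemma abs_huber_sub_huber_le (hb : 0 ≤ b) (s t : ℝ) :
    |huber H b s - huber H b t| ≤ b * |s - t| := by
  have h := Convex.norm_image_sub_le_of_norm_hasDerivWithin_le (f := huber H b)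
    (f' := huberSlope H b) (C := b) (fun x _ => (hasDerivAt_huber x).hasDerivWithinAt)
    (fun x _ => abs_huberSlope_le hb x) convex_univ (Set.mem_univ t) (Set.mem_univ s)
  simpa using h

/-- The intercepts at `x₀` of the tangent lines of two Huber functions differ by a bounded
amount, because far from both centres the slopes agree. -/
lemma abs_huber_intercept_le (hH : 0 < H) (hb : 0 ≤ b) {c R x₀ : ℝ} (hc : |x₀ - c| ≤ R)
    (x : ℝ) :
    |huber H b (x - c) - huber H b (x - x₀) -
      (huberSlope H b (x - c) - huberSlope H b (x - x₀)) * (x - x₀)| ≤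
      b * R + 2 * b * (R + b / H) := by
  have hR : 0 ≤ R := (abs_nonneg _).trans hc
  have h1 : |huber H b (x - c) - huber H b (x - x₀)| ≤ b * R := by
    refine (abs_huber_sub_huber_le hb _ _).trans ?_
    rw [show x - c - (x - x₀) = x₀ - c by ring]
    gcongr
  have h2 : |(huberSlope H b (x - c) - huberSlope H b (x - x₀)) * (x - x₀)| ≤
      2 * b * (R + b / H) := by
    have hpos : 0 ≤ R + b / H := by positivity
    rcases le_or_gt |x - x₀| (R + b / H) with h | h
    · rw [abs_mul]
      have h3 : |huberSlope H b (x - c) - huberSlope H b (x - x₀)| ≤ 2 * b := by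
        have := abs_sub (huberSlope H b (x - c)) (huberSlope H b (x - x₀))
        have e1 := abs_huberSlope_le (H := H) hb (x - c)
        have e2 := abs_huberSlope_le (H := H) hb (x - x₀)
        linarith
      gcongr
    · obtain ⟨hc1, hc2⟩ := abs_le.1 hc
      have hbH : H * (b / H) = b := by field_simp
      have key : huberSlope H b (x - c) = huberSlope H b (x - x₀) := by
        rcases lt_abs.1 h with h | h
        · rw [huberSlope_eq_of_le hb, huberSlope_eq_of_le hb]
          · calc b = H * (b / H) := hbH.symm
              _ ≤ _ := by gcongr; linarith
          · calc b = H * (b / H) := hbH.symm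
              _ ≤ _ := by gcongr; linarith
        · rw [huberSlope_eq_of_le_neg hb, huberSlope_eq_of_le_neg hb]
          · calc H * (x - x₀) ≤ H * (-(b / H)) := by gcongr; linarith
              _ = -b := by rw [mul_neg, hbH]
          · calc H * (x - c) ≤ H * (-(b / H)) := by gcongr; linarith
              _ = -b := by rw [mul_neg, hbH]
      rw [key]
      simp only [sub_self, zero_mul, abs_zero]
      positivity
  exact (abs_sub _ _).trans (add_le_add h1 h2)

end

/-! ### Optimising the information inequality -/

/-- The multiplier `log N` gives `δ * log N - log 2 ≤ X`, which suffices for large `N`. For small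
`N`, which matter only if `1 / 2 < δ`, the multiplier `log (δ / (1 - δ))` gives the entropy gap
`log 2 - binEntropy δ ≤ X`. -/
lemma exists_const_mul_log_le {δ : ℝ} (hδ₀ : 0 < δ) (hδ₁ : δ < 1) :
    ∃ c K : ℝ, 0 < c ∧ 1 ≤ K ∧ (1 / 2 < δ → K = 1) ∧ ∀ (N : ℕ) (L X : ℝ), K ≤ L → L ≤ N →
      (∀ l : ℝ, 0 ≤ l → l * δ ≤ X + Real.log (1 + (Real.exp l - 1) * (1 / N))) →
      c * Real.log L ≤ X := by
  have hlog2 : 0 < Real.log 2 := Real.log_pos one_lt_two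
  have hlarge : ∀ (N : ℕ) (L X : ℝ), 1 ≤ L → L ≤ N → 2 * Real.log 2 / δ ≤ Real.log N →
      (∀ l : ℝ, 0 ≤ l → l * δ ≤ X + Real.log (1 + (Real.exp l - 1) * (1 / N))) →
      δ / 2 * Real.log L ≤ X := by
    intro N L X hL hLN hN h
    have hN1 : (1 : ℝ) ≤ N := hL.trans hLN
    have h1 := h (Real.log N) (Real.log_nonneg hN1)
    rw [Real.exp_log (by linarith)] at h1
    have h2 : Real.log (1 + ((N : ℝ) - 1) * (1 / N)) ≤ Real.log 2 := by
      have h3 : ((N : ℝ) - 1) * (1 / N) ≤ 1 := by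
        rw [mul_one_div, div_le_one (by linarith)]; linarith
      have h4 : 0 ≤ ((N : ℝ) - 1) * (1 / N) := mul_nonneg (by linarith) (by positivity)
      exact Real.log_le_log (by linarith) (by linarith)
    have h5 : Real.log L ≤ Real.log N := Real.log_le_log (by linarith) hLN
    rw [div_le_iff₀ hδ₀] at hN
    nlinarith
  by_cases hδ : 1 / 2 < δ
  · have hgap : 0 < Real.log 2 - Real.binEntropy δ :=
      sub_pos.2 (Real.binEntropy_lt_log_two.2 (by intro h; rw [h] at hδ; norm_num at hδ))
    refine ⟨min (δ / 2) ((Real.log 2 - Real.binEntropy δ) / (2 * Real.log 2 / δ)), 1,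
      lt_min (by positivity) (by positivity), le_rfl, fun _ => rfl, fun N L X hL hLN h => ?_⟩
    have hlogL : 0 ≤ Real.log L := Real.log_nonneg hL
    rcases le_or_gt (2 * Real.log 2 / δ) (Real.log N) with hN | hN
    · exact (mul_le_mul_of_nonneg_right (min_le_left _ _) hlogL).trans
        (hlarge N L X hL hLN hN h)
    rcases hL.eq_or_lt with rfl | hL1
    · have := h 0 le_rfl
      simpa using this
    have hN2 : (2 : ℝ) ≤ N := by
      have : 1 < N := by exact_mod_cast hL1.trans_le hLN
      exact_mod_cast this
    have hδ' : 0 < 1 - δ := by linarith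
    have h1 := h (Real.log (δ / (1 - δ)))
      (Real.log_nonneg (by rw [le_div_iff₀ hδ']; linarith))
    rw [Real.exp_log (by positivity)] at h1
    have h2 : Real.log (1 + (δ / (1 - δ) - 1) * (1 / N)) ≤ Real.log ((1 - δ)⁻¹ / 2) := by
      have e1 : 0 ≤ δ / (1 - δ) - 1 := by
        rw [sub_nonneg, le_div_iff₀ hδ']; linarith
      have e2 : (1 : ℝ) / N ≤ 1 / 2 := one_div_le_one_div_of_le two_pos hN2
      refine Real.log_le_log (by positivity) ?_
      calc 1 + (δ / (1 - δ) - 1) * (1 / N) ≤ 1 + (δ / (1 - δ) - 1) * (1 / 2) := by gcongr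
        _ = (1 - δ)⁻¹ / 2 := by field_simp; ring
    rw [Real.log_div (by positivity) two_ne_zero, Real.log_inv] at h2
    rw [Real.log_div hδ₀.ne' hδ'.ne'] at h1
    have h3 : Real.log 2 - Real.binEntropy δ ≤ X := by
      rw [Real.binEntropy_eq_negMulLog_add_negMulLog_one_sub, Real.negMulLog, Real.negMulLog]
      linarith
    have h4 : Real.log L ≤ 2 * Real.log 2 / δ :=
      (Real.log_le_log (by linarith) hLN).trans hN.le
    calc _ ≤ (Real.log 2 - Real.binEntropy δ) / (2 * Real.log 2 / δ) * (2 * Real.log 2 / δ) :=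
          mul_le_mul (min_le_right _ _) h4 hlogL (by positivity)
      _ = Real.log 2 - Real.binEntropy δ := by field_simp
      _ ≤ X := h3
  · have hK : 1 ≤ Real.exp (2 * Real.log 2 / δ) := Real.one_le_exp (by positivity)
    refine ⟨δ / 2, Real.exp (2 * Real.log 2 / δ), by positivity, hK, fun h => absurd h hδ,
      fun N L X hL hLN h => hlarge N L X (hK.trans hL) hLN ?_ h⟩
    rw [Real.le_log_iff_exp_le (by linarith)]
    exact hL.trans hLN

/-! ### The lower bound -/

/-- The information inequality for a run of unbounded length. -/
lemma mul_outputEvent_le (A : OracleAlgorithm.{u}) {F F₀ : ℝ → ℝ} (hF : Differentiable ℝ F)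
    (hF₀ : Differentiable ℝ F₀) {x₀ σ κ l : ℝ} {v : ℝ≥0} (hκ : 0 ≤ κ)
    (hent : AnswerEntropyLE (noiseLaw v σ) (gaussianOracle F hF x₀ σ v).answer
      (gaussianOracle F₀ hF₀ x₀ σ v).answer κ) (hl : 0 ≤ l) {G : Set ℝ} (hG : MeasurableSet G)
    (hfin : A.expectedQueries (gaussianOracle F hF x₀ σ v) ≠ ⊤) :
    l * (A.runLaw (gaussianOracle F hF x₀ σ v)).real
        (A.outputEvent (gaussianOracle F hF x₀ σ v) G) ≤
      κ * (A.expectedQueries (gaussianOracle F hF x₀ σ v)).toReal +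
      Real.log (1 + (Real.exp l - 1) * (A.runLaw (gaussianOracle F₀ hF₀ x₀ σ v)).real
        (A.outputEvent (gaussianOracle F₀ hF₀ x₀ σ v) G)) := by
  have hP := measurable_gaussianOracle_answer hF x₀ σ v
  have hQ := measurable_gaussianOracle_answer hF₀ x₀ σ v
  have tP := OracleAlgorithm.tendsto_integral_meanPayoff (A := A)
    (O := gaussianOracle F hF x₀ σ v) hP hG
  have tQ := OracleAlgorithm.tendsto_integral_meanPayoff (A := A)
    (O := gaussianOracle F₀ hF₀ x₀ σ v) hQ hG
  have hpos : 1 + (Real.exp l - 1) * (A.runLaw (gaussianOracle F₀ hF₀ x₀ σ v)).real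
      (A.outputEvent (gaussianOracle F₀ hF₀ x₀ σ v) G) ≠ 0 :=
    (add_pos_of_pos_of_nonneg one_pos
      (mul_nonneg (sub_nonneg.2 (Real.one_le_exp hl)) measureReal_nonneg)).ne'
  refine le_of_tendsto_of_tendsto' (tP.const_mul l)
    ((((tQ.const_mul (Real.exp l - 1)).const_add 1).log hpos).const_add _) fun m => ?_
  refine (OracleAlgorithm.mul_integral_meanPayoff_le hP hQ (fun k => A.measurable_output k hG)
    hκ hent hl m).trans (add_le_add (mul_le_mul_of_nonneg_left ?_ hκ) le_rfl)
  exact OracleAlgorithm.integral_meanPayoff_one_le (O := gaussianOracle F hF x₀ σ v) hP hfin m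

/-- Equally spaced points: an interval of half-length `R` contains `⌈R / r⌉` centres of pairwise
disjoint closed intervals of radius `r`. -/
lemma exists_separated_centres {R r : ℝ} (hR : 0 < R) (hr : 0 < r) (x₀ : ℝ) :
    ∃ (N : ℕ) (c : Fin N → ℝ), R / r ≤ N ∧ (∀ i, |x₀ - c i| ≤ R) ∧
      ∀ i j, i ≠ j → 2 * r < |c i - c j| := by
  let N := ⌈R / r⌉₊
  -- for `N = 1` the spacing `2 * R / (N - 1)` is the junk value `0` and plays no role
  refine ⟨N, fun i => x₀ - R + i * (2 * R / ((N : ℝ) - 1)), Nat.le_ceil _,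
    fun i => ?_, fun i j hij => ?_⟩
  · have hi : ((i : ℕ) : ℝ) ≤ (N : ℝ) - 1 := by
      have : ((i : ℕ) : ℝ) + 1 ≤ N := by exact_mod_cast i.2
      linarith
    have h0 : (0 : ℝ) ≤ (i : ℕ) := Nat.cast_nonneg _
    have h1 : 0 ≤ ((i : ℕ) : ℝ) * (2 * R / ((N : ℝ) - 1)) :=
      mul_nonneg h0 (div_nonneg (by linarith) (by linarith))
    have h2 : ((i : ℕ) : ℝ) * (2 * R / ((N : ℝ) - 1)) ≤ 2 * R := by
      rcases (h0.trans hi).eq_or_lt with h | h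
      · rw [← h]; simpa using hR.le
      · rw [mul_div_assoc', div_le_iff₀ h]; nlinarith
    rw [abs_le]
    constructor <;> linarith
  · have hN1 : 0 < (N : ℝ) - 1 := by
      have : 1 < N := by
        by_contra h
        exact hij (Fin.ext (by omega))
      have : (1 : ℝ) < N := by exact_mod_cast this
      linarith
    have hlt : (N : ℝ) - 1 < R / r := by
      have := Nat.ceil_lt_add_one (show 0 ≤ R / r by positivity)
      linarith
    have hone : (1 : ℝ) ≤ |((i : ℕ) : ℝ) - (j : ℕ)| := by
      have h : ((i : ℕ) : ℤ) - (j : ℕ) ≠ 0 := by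
        intro h
        exact hij (Fin.ext (by omega))
      exact_mod_cast Int.one_le_abs h
    have hsp : 2 * r < 2 * R / ((N : ℝ) - 1) := by
      rw [lt_div_iff₀ hN1]
      rw [lt_div_iff₀ hr] at hlt
      nlinarith
    have hpos : 0 < 2 * R / ((N : ℝ) - 1) := by positivity
    calc 2 * r < 1 * (2 * R / ((N : ℝ) - 1)) := by rwa [one_mul]
      _ ≤ |((i : ℕ) : ℝ) - (j : ℕ)| * (2 * R / ((N : ℝ) - 1)) := by gcongr
      _ = _ := by
        rw [← abs_of_pos hpos, ← abs_mul, abs_of_pos hpos]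
        congr 1
        ring

/-- The first lower bound, with the constants `c` and `K` of `exists_const_mul_log_le`. The family
consists of Huber functions with slopes `±2 ε`, the oracle for the Huber function centred at `x₀`
is the reference, and `9 * (ε ^ 2 / σ ^ 2)` bounds the relative entropy of one answer. -/
theorem hasQueryLowerBound_domainBounded {δ c K : ℝ} (hK : 1 ≤ K)
    (hcK : ∀ (N : ℕ) (L X : ℝ), K ≤ L → L ≤ N →
      (∀ l : ℝ, 0 ≤ l → l * δ ≤ X + Real.log (1 + (Real.exp l - 1) * (1 / N))) →
      c * Real.log L ≤ X)
    {H R σ ε : ℝ} (x₀ : ℝ) (hH : 0 < H) (hR : 0 < R) (hσ : 0 < σ) (hε : 0 < ε)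
    (hL : K ≤ H * R / ε) :
    HasQueryLowerBound.{u} (DomainBounded H R x₀) σ ε δ
      (c / 9 * (σ ^ 2 / ε ^ 2 * Real.log (H * R / ε))) := by
  have hLr : H * R / ε = R / (ε / H) := by field_simp
  obtain ⟨N, x, hLN, hxR, hsep⟩ := exists_separated_centres hR (r := ε / H) (by positivity) x₀
  rw [hLr] at hL ⊢
  have hNpos : (0 : ℝ) < N := one_pos.trans_le ((hK.trans hL).trans hLN)
  have hb : 0 ≤ 2 * ε := by positivity
  set a : ℝ := 2 * ε * R + 2 * (2 * ε) * (R + 2 * ε / H) with ha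
  have hapos : 0 < a := by positivity
  -- so much noise in the function values that they carry less information than the gradients
  set v : ℝ≥0 := (a ^ 2 * σ ^ 2 / (2 * ε ^ 2)).toNNReal with hv
  have hvpos : 0 < a ^ 2 * σ ^ 2 / (2 * ε ^ 2) := by positivity
  have hvcoe : (v : ℝ) = a ^ 2 * σ ^ 2 / (2 * ε ^ 2) := Real.coe_toNNReal _ hvpos.le
  have hv0 : v ≠ 0 := (Real.toNNReal_pos.2 hvpos).ne'
  have hd : ∀ y : ℝ, Differentiable ℝ (fun t => huber H (2 * ε) (t - y)) :=
    differentiable_huber_sub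
  have hκ : a ^ 2 / (2 * v) + (4 * ε) ^ 2 / (2 * σ ^ 2) = 9 * (ε ^ 2 / σ ^ 2) := by
    rw [hvcoe]
    field_simp
    ring
  have hent : ∀ i, AnswerEntropyLE (noiseLaw v σ) (gaussianOracle _ (hd (x i)) x₀ σ v).answer
      (gaussianOracle _ (hd x₀) x₀ σ v).answer (9 * (ε ^ 2 / σ ^ 2)) := fun i => by
    rw [← hκ]
    refine answerEntropyLE_gaussianOracle _ _ hv0 hσ (fun y => ?_) (fun y => ?_)
    · rw [deriv_huber_sub, deriv_huber_sub]
      exact abs_huber_intercept_le hH hb (hxR i) y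
    · rw [deriv_huber_sub, deriv_huber_sub]
      have e0 := abs_sub (huberSlope H (2 * ε) (y - x i)) (huberSlope H (2 * ε) (y - x₀))
      have e1 := abs_huberSlope_le (H := H) hb (y - x i)
      have e2 := abs_huberSlope_le (H := H) hb (y - x₀)
      linarith
  let G : Fin N → Set ℝ := fun i => {y | |deriv (fun t => huber H (2 * ε) (t - x i)) y| ≤ ε}
  have hG : ∀ i, MeasurableSet (G i) := fun i =>
    measurableSet_le (measurable_deriv _).abs measurable_const
  have hGsub : ∀ i, ∀ y ∈ G i, |y - x i| ≤ ε / H := fun i y hy => by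
    have hy' : |deriv (fun t => huber H (2 * ε) (t - x i)) y| ≤ ε := hy
    rw [deriv_huber_sub] at hy'
    have := abs_mul_le_of_abs_huberSlope_le (by linarith) hy'
    rw [abs_mul, abs_of_pos hH] at this
    rw [le_div_iff₀ hH]
    linarith
  have hdisj : Pairwise fun i j => Disjoint (G i) (G j) := fun i j hij => by
    refine Set.disjoint_left.2 fun y hi hj => ?_
    have h1 := hGsub i y hi
    have h2 := hGsub j y hj
    have h3 := abs_sub (y - x j) (y - x i)
    rw [show y - x j - (y - x i) = x i - x j by ring] at h3
    linarith [hsep i j hij]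
  refine ⟨N, fun i t => huber H (2 * ε) (t - x i), fun i => gaussianOracle _ (hd (x i)) x₀ σ v,
    fun i => huber_sub_mem_domainBounded hH.le hb (hxR i), fun A hA => ?_⟩
  obtain ⟨i, hi⟩ : ∃ i, (A.runLaw (gaussianOracle _ (hd x₀) x₀ σ v)).real
      (A.outputEvent (gaussianOracle _ (hd x₀) x₀ σ v) (G i)) ≤ 1 / N := by
    have hsum := OracleAlgorithm.sum_outputEvent_le_one (A := A)
      (O := gaussianOracle _ (hd x₀) x₀ σ v) (measurable_gaussianOracle_answer (hd x₀) x₀ σ v) hG hdisj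
    have hne : (Finset.univ : Finset (Fin N)).Nonempty :=
      ⟨⟨0, by exact_mod_cast hNpos⟩, Finset.mem_univ _⟩
    obtain ⟨i, -, hi⟩ := Finset.exists_le_of_sum_le hne
      (f := fun i => (A.runLaw (gaussianOracle _ (hd x₀) x₀ σ v)).real
        (A.outputEvent (gaussianOracle _ (hd x₀) x₀ σ v) (G i)))
      (g := fun _ => 1 / (N : ℝ)) (by simpa [hNpos.ne'] using hsum)
    exact ⟨i, hi⟩
  refine ⟨i, ?_⟩
  by_cases hfin : A.expectedQueries (gaussianOracle _ (hd (x i)) x₀ σ v) = ⊤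
  · rw [hfin]
    exact le_top
  refine (ENNReal.ofReal_le_iff_le_toReal hfin).2 ?_
  have hsucc : δ ≤ (A.runLaw (gaussianOracle _ (hd (x i)) x₀ σ v)).real
      (A.outputEvent (gaussianOracle _ (hd (x i)) x₀ σ v) (G i)) :=
    (ENNReal.ofReal_le_iff_le_toReal (measure_ne_top _ _)).1 (hA i)
  have key := hcK N (R / (ε / H)) (9 * (ε ^ 2 / σ ^ 2) *
    (A.expectedQueries (gaussianOracle _ (hd (x i)) x₀ σ v)).toReal) hL hLN fun l hl => by
      refine (mul_le_mul_of_nonneg_left hsucc hl).trans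
        ((mul_outputEvent_le A _ (hd x₀) (by positivity) (hent i) hl (hG i) hfin).trans ?_)
      have he : 0 ≤ Real.exp l - 1 := sub_nonneg.2 (Real.one_le_exp hl)
      refine add_le_add le_rfl (Real.log_le_log ?_ ?_)
      · exact add_pos_of_pos_of_nonneg one_pos (mul_nonneg he measureReal_nonneg)
      · gcongr
  calc c / 9 * (σ ^ 2 / ε ^ 2 * Real.log (R / (ε / H)))
      = σ ^ 2 / (9 * ε ^ 2) * (c * Real.log (R / (ε / H))) := by ring
    _ ≤ σ ^ 2 / (9 * ε ^ 2) * (9 * (ε ^ 2 / σ ^ 2) *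
        (A.expectedQueries (gaussianOracle _ (hd (x i)) x₀ σ v)).toReal) := by gcongr
    _ = _ := by field_simp

/-- By smoothness, a minimiser within distance `√(Δ / H)` gives an initial gap of at most `Δ`. -/
lemma domainBounded_subset_rangeBounded {H Δ : ℝ} (hH : 0 < H) (hΔ : 0 ≤ Δ) (x₀ : ℝ) :
    DomainBounded H (√(Δ / H)) x₀ ⊆ RangeBounded H Δ x₀ := by
  rintro F ⟨hsm, hconv, xs, hmin, hx⟩
  refine ⟨hsm, hconv, xs, hmin, ?_⟩
  have hd : deriv F xs = 0 := IsLocalMin.deriv_eq_zero (.of_forall hmin)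
  have h := hsm.2 xs x₀
  rw [hd] at h
  have h2 : (x₀ - xs) ^ 2 ≤ Δ / H := by
    rw [← Real.sq_sqrt (show 0 ≤ Δ / H by positivity)]
    exact sq_le_sq' (abs_le.1 hx).1 (abs_le.1 hx).2
  rw [le_div_iff₀ hH] at h2
  nlinarith

lemma HasQueryLowerBound.mono {C C' : Set (ℝ → ℝ)} {σ ε δ b : ℝ} (hC : C ⊆ C')
    (h : HasQueryLowerBound.{u} C σ ε δ b) : HasQueryLowerBound.{u} C' σ ε δ b := by
  obtain ⟨N, F, O, hF, hO⟩ := h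
  exact ⟨N, F, O, fun i => hC (hF i), hO⟩

theorem mainTheorem8 (δ : ℝ) (hδ₀ : 0 < δ) (hδ₁ : δ < 1) :
    ∃ c K : ℝ, 0 < c ∧ 1 ≤ K ∧ (1 / 2 < δ → K = 1) ∧
      (∀ H R σ ε x₀ : ℝ, 0 < H → 0 < R → 0 < ε → ε < σ / 2 → K ≤ H * R / ε →
        HasQueryLowerBound.{u} (DomainBounded H R x₀) σ ε δ
          (c * (σ ^ 2 / ε ^ 2 * Real.log (H * R / ε)))) ∧
      (∀ H Δ σ ε x₀ : ℝ, 0 < H → 0 < Δ → 0 < ε → ε < σ / 2 → K ≤ H * Δ / ε ^ 2 →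
        HasQueryLowerBound.{u} (RangeBounded H Δ x₀) σ ε δ
          (c * (σ ^ 2 / ε ^ 2 * Real.log (H * Δ / ε ^ 2)))) := by
  obtain ⟨c, K, hc, hK, hKδ, hcK⟩ := exists_const_mul_log_le hδ₀ hδ₁
  -- the second bound is the first one for `H * R / ε = √(H * Δ / ε ^ 2)`, which halves the
  -- logarithm and squares the threshold
  have hbound : ∀ {H R σ ε x₀ : ℝ}, 0 < H → 0 < R → 0 < ε → ε < σ / 2 → K ≤ H * R / ε →
      HasQueryLowerBound.{u} (DomainBounded H R x₀) σ ε δ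
        (c / 9 * (σ ^ 2 / ε ^ 2 * Real.log (H * R / ε))) :=
    fun {H R σ ε x₀} hH hR hε hσ hL =>
      hasQueryLowerBound_domainBounded hK hcK x₀ hH hR (by linarith) hε hL
  refine ⟨c / 18, K ^ 2, by positivity, one_le_pow₀ hK, fun h => by rw [hKδ h]; norm_num,
    fun H R σ ε x₀ hH hR hε hσ hL => ?_, fun H Δ σ ε x₀ hH hΔ hε hσ hL => ?_⟩
  · have hKL : K ≤ H * R / ε := le_trans (by nlinarith) hL
    obtain ⟨N, F, O, hF, hO⟩ := hbound (x₀ := x₀) hH hR hε hσ hKL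
    refine ⟨N, F, O, hF, fun A hA => ?_⟩
    obtain ⟨i, hi⟩ := hO A hA
    refine ⟨i, le_trans (ENNReal.ofReal_le_ofReal ?_) hi⟩
    have : 0 ≤ Real.log (H * R / ε) := Real.log_nonneg (hK.trans hKL)
    gcongr
    linarith
  · have hR : 0 < √(Δ / H) := Real.sqrt_pos.2 (by positivity)
    have hsq : (H * √(Δ / H) / ε) ^ 2 = H * Δ / ε ^ 2 := by
      rw [div_pow, mul_pow, Real.sq_sqrt (by positivity)]
      field_simp
    have hKL : K ≤ H * √(Δ / H) / ε := by
      rw [← hsq] at hL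
      exact (pow_le_pow_iff_left₀ (by linarith) (by positivity) two_ne_zero).1 hL
    have h := (hbound (x₀ := x₀) hH hR hε hσ hKL).mono
      (domainBounded_subset_rangeBounded hH hΔ.le x₀)
    have heq : c / 18 * (σ ^ 2 / ε ^ 2 * Real.log (H * Δ / ε ^ 2)) =
        c / 9 * (σ ^ 2 / ε ^ 2 * Real.log (H * √(Δ / H) / ε)) := by
      rw [← hsq, Real.log_pow]
      push_cast
      ring
    rwa [heq]
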